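/- Let $K$ be a field of characteristic $0$ and let $G\subset \mathrm{SL}(2,K)$ be a finite subgroup scheme, i.e. $G=\operatorname{Spec}A$ is a finite group scheme over $K$ together with a closed immersion of group schemes into the group scheme $\mathrm{SL}(2)$ over $K$ (equivalently, $A$ is a finite-dimensional commutative Hopf algebra over $K$ with a surjective homomorphism of Hopf algebras $K[x_{11},x_{12},x_{21},x_{22}]/(x_{11}x_{22}-x_{12}x_{21}-1)\to A$). Let $L/K$ be a Galois extension (finite or infinite) with $\Gamma=\operatorname{Aut}_K(L)$, and let $A_L=L\otimes_KA$, $G_L=\operatorname{Spec}A_L$. A representation of $G$ is an $A$-comodule, i.e. a $K$-vector space $W$ with a structure map $\varrho:W\to A\otimes_KW$; its base extension $W_L=L\otimes_KW$ is a representation of $G_L$. For $\gamma\in\Gamma$ and a representation $(V,\varrho)$ of $G_L$, the conjugate representation $\gamma_*V$ is the abelian group $V$ with scalar multiplication $(l,v)\mapsto\gamma(l)v$ and with structure map $v\mapsto\sum_i(\gamma^{-1}\otimes\mathrm{id}_A)(a_i)\otimes v_i$ if $\varrho(v)=\sum_i a_i\otimes v_i$. Let $W$ be an irreducible representation of $G$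 over $K$. Denote by $m(W,L/K)$ the number $m$ such that every isotypic component $U$ of $W_L$ is a direct sum $U\cong V^{\oplus m}$ of $m$ copies of an irreducible representation $V$ of $G_L$. Then \[ m(W,L/K)=1. \] Moreover, $W_L$ decomposes as a finite direct sum $W_L=\bigoplus_{i}V_i$ of irreducible representations $V_i$ of $G_L$ which are pairwise nonisomorphic and are $\Gamma$-conjugate to each other: for all $i,j$ there is $\gamma\in\Gamma$ with $V_j\cong\gamma_*V_i$. -/

import Mathlib

open scoped TensorProduct

noncomputable section

/-! ### The group scheme `SL(2)` over `K`, through its coordinate Hopf algebra -/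

/-- The coordinate ring `K[x₀₀, x₀₁, x₁₀, x₁₁] / (det - 1)` of the group scheme `SL(2, K)`. -/
def SL2Ring (K : Type*) [Field K] : Type _ :=
  MvPolynomial (Fin 2 × Fin 2) K ⧸
    Ideal.span {(Matrix.mvPolynomialX (Fin 2) (Fin 2) K).det - 1}

namespace SL2Ring

instance instCommRing (K : Type*) [Field K] : CommRing (SL2Ring K) :=
  inferInstanceAs (CommRing (MvPolynomial (Fin 2 × Fin 2) K ⧸
    Ideal.span {(Matrix.mvPolynomialX (Fin 2) (Fin 2) K).det - 1}))

instance instAlgebra (K : Type*) [Field K] : Algebra K (SL2Ring K) :=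
  inferInstanceAs (Algebra K (MvPolynomial (Fin 2 × Fin 2) K ⧸
    Ideal.span {(Matrix.mvPolynomialX (Fin 2) (Fin 2) K).det - 1}))

/-- The quotient map. -/
def mk (K : Type*) [Field K] : MvPolynomial (Fin 2 × Fin 2) K →ₐ[K] SL2Ring K :=
  Ideal.Quotient.mkₐ K (Ideal.span {(Matrix.mvPolynomialX (Fin 2) (Fin 2) K).det - 1})

/-- The universal matrix of determinant `1`. -/
def generic (K : Type*) [Field K] : Matrix.SpecialLinearGroup (Fin 2) (SL2Ring K) :=
  ⟨(mk K).mapMatrix (Matrix.mvPolynomialX (Fin 2) (Fin 2) K), by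
    rw [← AlgHom.map_det, ← sub_eq_zero, ← map_one (mk K), ← map_sub]
    exact Ideal.Quotient.eq_zero_iff_mem.2 (Ideal.subset_span rfl)⟩

/-- The homomorphism of `K`-algebras `SL2Ring K → B` given by a `B`-valued point of `SL(2)`. -/
def lift {K : Type*} [Field K] {B : Type*} [CommRing B] [Algebra K B]
    (M : Matrix.SpecialLinearGroup (Fin 2) B) : SL2Ring K →ₐ[K] B :=
  Ideal.Quotient.liftₐ _ (MvPolynomial.aeval fun p : Fin 2 × Fin 2 => M.1 p.1 p.2) (by
    intro a ha
    refine (Ideal.span_le (I := RingHom.ker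
      (MvPolynomial.aeval (R := K) fun p : Fin 2 × Fin 2 => M.1 p.1 p.2))).2 ?_ ha
    rintro _ rfl
    have h := M.2
    rw [Matrix.det_fin_two] at h
    simp [RingHom.mem_ker, Matrix.det_fin_two, Matrix.mvPolynomialX, h])

theorem lift_generic {K : Type*} [Field K] {B : Type*} [CommRing B] [Algebra K B]
    (M : Matrix.SpecialLinearGroup (Fin 2) B) (i j : Fin 2) :
    lift (K := K) M ((generic K).1 i j) = M.1 i j := by
  change MvPolynomial.aeval (fun p : Fin 2 × Fin 2 => M.1 p.1 p.2)
    (Matrix.mvPolynomialX (Fin 2) (Fin 2) K i j) = M.1 i j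
  simp

theorem hom_ext {K : Type*} [Field K] {B : Type*} [Semiring B] [Algebra K B]
    {f g : SL2Ring K →ₐ[K] B}
    (h : ∀ i j, f ((generic K).1 i j) = g ((generic K).1 i j)) : f = g := by
  refine Ideal.Quotient.algHom_ext K ?_
  refine MvPolynomial.algHom_ext ?_
  rintro ⟨i, j⟩
  exact h i j

/-- Comultiplication: `x i j ↦ ∑ k, x i k ⊗ x k j`, the product of matrices. -/
def comulHom (K : Type*) [Field K] : SL2Ring K →ₐ[K] SL2Ring K ⊗[K] SL2Ring K :=
  lift (Matrix.SpecialLinearGroup.map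
      (Algebra.TensorProduct.includeLeft : SL2Ring K →ₐ[K] SL2Ring K ⊗[K] SL2Ring K).toRingHom
      (generic K) *
    Matrix.SpecialLinearGroup.map
      (Algebra.TensorProduct.includeRight : SL2Ring K →ₐ[K] SL2Ring K ⊗[K] SL2Ring K).toRingHom
      (generic K))

/-- Counit: the unit matrix. -/
def counitHom (K : Type*) [Field K] : SL2Ring K →ₐ[K] K := lift 1

/-- Antipode: the inverse matrix. -/
def antipodeHom (K : Type*) [Field K] : SL2Ring K →ₐ[K] SL2Ring K := lift (generic K)⁻¹

theorem comulHom_generic (K : Type*) [Field K] (i j : Fin 2) :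
    comulHom K ((generic K).1 i j) =
      ∑ k, (generic K).1 i k ⊗ₜ[K] (generic K).1 k j := by
  rw [comulHom, lift_generic]
  simp [Matrix.mul_apply]

theorem counitHom_generic (K : Type*) [Field K] (i j : Fin 2) :
    counitHom K ((generic K).1 i j) = (1 : Matrix (Fin 2) (Fin 2) K) i j := by
  rw [counitHom, lift_generic]; rfl

instance instBialgebra (K : Type*) [Field K] : Bialgebra K (SL2Ring K) :=
  Bialgebra.ofAlgHom (comulHom K) (counitHom K)
    (hom_ext fun i j => by
      simp [comulHom_generic, TensorProduct.tmul_add, TensorProduct.add_tmul]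
      abel)
    (hom_ext fun i j => by
      fin_cases i <;> fin_cases j <;> simp [comulHom_generic, counitHom_generic])
    (hom_ext fun i j => by
      fin_cases i <;> fin_cases j <;> simp [comulHom_generic, counitHom_generic])

instance instHopfAlgebra (K : Type*) [Field K] : HopfAlgebra K (SL2Ring K) where
  antipode := (antipodeHom K).toLinearMap
  mul_antipode_rTensor_comul := by
    have h : ((Algebra.TensorProduct.lmul' K).comp
        (Algebra.TensorProduct.map (antipodeHom K) (AlgHom.id K (SL2Ring K)))).comp (comulHom K) =
        (Algebra.ofId K (SL2Ring K)).comp (counitHom K) := by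
      refine hom_ext fun i j => ?_
      have h1 := congrArg (fun M => M.1 i j) (inv_mul_cancel (generic K))
      rw [AlgHom.comp_apply, AlgHom.comp_apply, AlgHom.comp_apply, comulHom_generic,
        counitHom_generic]
      simp only [Matrix.SpecialLinearGroup.coe_mul, Matrix.mul_apply, Fin.sum_univ_two] at h1
      simp only [Fin.sum_univ_two, map_add, Algebra.TensorProduct.map_tmul, AlgHom.id_apply,
        Algebra.TensorProduct.lmul'_apply_tmul, antipodeHom, lift_generic]
      rw [h1]
      by_cases hij : i = j <;> simp [Matrix.one_apply, hij]
    exact congrArg AlgHom.toLinearMap h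
  mul_antipode_lTensor_comul := by
    have h : ((Algebra.TensorProduct.lmul' K).comp
        (Algebra.TensorProduct.map (AlgHom.id K (SL2Ring K)) (antipodeHom K))).comp (comulHom K) =
        (Algebra.ofId K (SL2Ring K)).comp (counitHom K) := by
      refine hom_ext fun i j => ?_
      have h1 := congrArg (fun M => M.1 i j) (mul_inv_cancel (generic K))
      rw [AlgHom.comp_apply, AlgHom.comp_apply, AlgHom.comp_apply, comulHom_generic,
        counitHom_generic]
      simp only [Matrix.SpecialLinearGroup.coe_mul, Matrix.mul_apply, Fin.sum_univ_two] at h1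
      simp only [Fin.sum_univ_two, map_add, Algebra.TensorProduct.map_tmul, AlgHom.id_apply,
        Algebra.TensorProduct.lmul'_apply_tmul, antipodeHom, lift_generic]
      rw [h1]
      by_cases hij : i = j <;> simp [Matrix.one_apply, hij]
    exact congrArg AlgHom.toLinearMap h

end SL2Ring

/-! ### Representations of an affine group scheme `Spec A`: comodules over `A` -/

/-- An `A`-comodule structure on the `K`-vector space `V`.  For a Hopf algebra `A` this is a
representation of the group scheme `Spec A` on `V`. -/
structure Coaction (K A V : Type*) [Field K] [AddCommGroup A] [Module K A] [Coalgebra K A]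
    [AddCommGroup V] [Module K V] where
  /-- the structure map -/
  map : V →ₗ[K] A ⊗[K] V
  coassoc : (TensorProduct.assoc K A A V).toLinearMap ∘ₗ
      (Coalgebra.comul (R := K) (A := A)).rTensor V ∘ₗ map = map.lTensor A ∘ₗ map
  counit : (Coalgebra.counit (R := K) (A := A)).rTensor V ∘ₗ map = TensorProduct.mk K K V 1

namespace Coaction

section Basic

variable {K A V V' : Type*} [Field K] [AddCommGroup A] [Module K A] [Coalgebra K A]
  [AddCommGroup V] [Module K V] [AddCommGroup V'] [Module K V']

/-- `U` is a subrepresentation (subcomodule): `ρ U ⊆ A ⊗ U`. -/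
def IsStable (ρ : Coaction K A V) (U : Submodule K V) : Prop :=
  ∀ u ∈ U, ρ.map u ∈ LinearMap.range (U.subtype.lTensor A)

theorem lTensor_subtype_injective (A : Type*) [AddCommGroup A] [Module K A] (U : Submodule K V) :
    Function.Injective (U.subtype.lTensor A) :=
  Module.Flat.lTensor_preserves_injective_linearMap _ U.injective_subtype

/-- The restriction of the structure map of `V` to a subrepresentation. -/
def restrictMap (ρ : Coaction K A V) (U : Submodule K V) (hU : ρ.IsStable U) :
    U →ₗ[K] A ⊗[K] U :=
  (LinearEquiv.ofInjective (U.subtype.lTensor A)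
      (lTensor_subtype_injective A U)).symm.toLinearMap ∘ₗ
    (ρ.map ∘ₗ U.subtype).codRestrict _ fun u => hU u u.2

theorem lTensor_comp_restrictMap (ρ : Coaction K A V) (U : Submodule K V) (hU : ρ.IsStable U) :
    U.subtype.lTensor A ∘ₗ ρ.restrictMap U hU = ρ.map ∘ₗ U.subtype := by
  ext u
  have := LinearEquiv.apply_symm_apply (LinearEquiv.ofInjective (U.subtype.lTensor A)
      (lTensor_subtype_injective A U)) ((ρ.map ∘ₗ U.subtype).codRestrict _ (fun u => hU u u.2) u)
  exact congrArg Subtype.val this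

/-- A subrepresentation as a representation. -/
def restrict (ρ : Coaction K A V) (U : Submodule K V) (hU : ρ.IsStable U) : Coaction K A U where
  map := ρ.restrictMap U hU
  coassoc := by
    have h := ρ.lTensor_comp_restrictMap U hU
    have hinj : Function.Injective ((U.subtype.lTensor A).lTensor A) :=
      Module.Flat.lTensor_preserves_injective_linearMap _ (lTensor_subtype_injective A U)
    refine (LinearMap.cancel_left hinj).1 ?_
    have e1 : (U.subtype.lTensor A).lTensor A ∘ₗ (TensorProduct.assoc K A A U).toLinearMap ∘ₗ
        (Coalgebra.comul (R := K) (A := A)).rTensor U =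
        (TensorProduct.assoc K A A V).toLinearMap ∘ₗ
          (Coalgebra.comul (R := K) (A := A)).rTensor V ∘ₗ U.subtype.lTensor A := by
      refine TensorProduct.ext' fun a u => ?_
      simp only [LinearMap.comp_apply, LinearMap.rTensor_tmul, LinearMap.lTensor_tmul]
      generalize Coalgebra.comul (R := K) a = x
      induction x using TensorProduct.induction_on with
      | zero => simp
      | tmul x y => simp
      | add x y hx hy => simp only [TensorProduct.add_tmul, map_add, hx, hy]
    calc _ = ((U.subtype.lTensor A).lTensor A ∘ₗ (TensorProduct.assoc K A A U).toLinearMap ∘ₗ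
        (Coalgebra.comul (R := K) (A := A)).rTensor U) ∘ₗ ρ.restrictMap U hU := rfl
      _ = ((TensorProduct.assoc K A A V).toLinearMap ∘ₗ
          (Coalgebra.comul (R := K) (A := A)).rTensor V) ∘ₗ
            (U.subtype.lTensor A ∘ₗ ρ.restrictMap U hU) := by rw [e1]; rfl
      _ = (ρ.map.lTensor A ∘ₗ ρ.map) ∘ₗ U.subtype := by rw [h, ← ρ.coassoc]; rfl
      _ = ρ.map.lTensor A ∘ₗ (U.subtype.lTensor A ∘ₗ ρ.restrictMap U hU) := by rw [h]; rfl
      _ = ((ρ.map ∘ₗ U.subtype).lTensor A) ∘ₗ ρ.restrictMap U hU := by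
          rw [LinearMap.lTensor_comp]; rfl
      _ = _ := by rw [← h, LinearMap.lTensor_comp]; rfl
  counit := by
    have h := ρ.lTensor_comp_restrictMap U hU
    refine (LinearMap.cancel_left (lTensor_subtype_injective K U)).1 ?_
    have e1 : U.subtype.lTensor K ∘ₗ (Coalgebra.counit (R := K) (A := A)).rTensor U =
        (Coalgebra.counit (R := K) (A := A)).rTensor V ∘ₗ U.subtype.lTensor A :=
      TensorProduct.ext' fun a u => by simp
    calc _ = (U.subtype.lTensor K ∘ₗ (Coalgebra.counit (R := K) (A := A)).rTensor U) ∘ₗ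
          ρ.restrictMap U hU := rfl
      _ = (Coalgebra.counit (R := K) (A := A)).rTensor V ∘ₗ
          (U.subtype.lTensor A ∘ₗ ρ.restrictMap U hU) := by rw [e1]; rfl
      _ = ((Coalgebra.counit (R := K) (A := A)).rTensor V ∘ₗ ρ.map) ∘ₗ U.subtype := by rw [h]; rfl
      _ = _ := by rw [ρ.counit]; ext u; simp

/-- Isomorphism of representations. -/
def Iso (ρ : Coaction K A V) (ρ' : Coaction K A V') : Prop :=
  ∃ e : V ≃ₗ[K] V', ρ'.map ∘ₗ e.toLinearMap = e.toLinearMap.lTensor A ∘ₗ ρ.map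

/-- Irreducible (simple) representation: nonzero, with no subrepresentations other than `0`
and the whole space. -/
def IsIrreducible (ρ : Coaction K A V) : Prop :=
  Nontrivial V ∧ ∀ U : Submodule K V, ρ.IsStable U → U = ⊥ ∨ U = ⊤

/-- The isotypic component of `V` of type `V'`: the sum of all subrepresentations of `V`
isomorphic to `V'`. -/
def isotypicComponent (ρ : Coaction K A V) (ρ' : Coaction K A V') : Submodule K V :=
  sSup {U | ∃ hU : ρ.IsStable U, Iso (ρ.restrict U hU) ρ'}

/-- The isotypic component of `V` of type `V'` is the direct sum of `m` subrepresentations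
isomorphic to `V'`. -/
def IsotypicComponentIsPower (ρ : Coaction K A V) (ρ' : Coaction K A V') (m : ℕ) : Prop :=
  ∃ S : Fin m → Submodule K V,
    (∀ k, ∃ hS : ρ.IsStable (S k), Iso (ρ.restrict (S k) hS) ρ') ∧
    iSupIndep S ∧ ⨆ k, S k = ρ.isotypicComponent ρ'

end Basic

section BaseChange

variable {K A W : Type*} [Field K] [CommRing A] [HopfAlgebra K A] [AddCommGroup W] [Module K W]
variable (L : Type*) [Field L] [Algebra K L]

variable (K A W) in
/-- The map `a ⊗ w ↦ (1 ⊗ a) ⊗ (1 ⊗ w)`. -/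
def baseChangeAux : A ⊗[K] W →ₗ[K] (L ⊗[K] A) ⊗[L] (L ⊗[K] W) :=
  (TensorProduct.AlgebraTensorModule.distribBaseChange K L A W).toLinearMap.restrictScalars K ∘ₗ
    TensorProduct.mk K L (A ⊗[K] W) 1

theorem baseChangeAux_tmul (a : A) (w : W) :
    baseChangeAux K A W L (a ⊗ₜ w) = (1 ⊗ₜ a) ⊗ₜ (1 ⊗ₜ w) := by
  simp [baseChangeAux]

variable (K A W) in
/-- The map `a ⊗ (b ⊗ w) ↦ (1 ⊗ a) ⊗ ((1 ⊗ b) ⊗ (1 ⊗ w))`. -/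
def baseChangeAux₂ :
    A ⊗[K] (A ⊗[K] W) →ₗ[K] (L ⊗[K] A) ⊗[L] ((L ⊗[K] A) ⊗[L] (L ⊗[K] W)) :=
  TensorProduct.lift
    (((TensorProduct.mk L (L ⊗[K] A) ((L ⊗[K] A) ⊗[L] (L ⊗[K] W))).restrictScalars₁₂ K K).compl₁₂
      (TensorProduct.mk K L A 1) (baseChangeAux K A W L))

theorem baseChangeAux₂_tmul (a : A) (x : A ⊗[K] W) :
    baseChangeAux₂ K A W L (a ⊗ₜ x) = (1 ⊗ₜ a) ⊗ₜ baseChangeAux K A W L x := by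
  simp [baseChangeAux₂]

theorem comul_one_tmul (a : A) :
    Coalgebra.comul (R := L) ((1 : L) ⊗ₜ[K] a) =
      baseChangeAux K A A L (Coalgebra.comul (R := K) a) := by
  rw [TensorProduct.comul_tmul]
  generalize Coalgebra.comul (R := K) a = y
  induction y using TensorProduct.induction_on with
  | zero => simp
  | add x y hx hy => simp only [map_add, TensorProduct.tmul_add, hx, hy]
  | tmul b c => simp [baseChangeAux_tmul]

theorem assoc_baseChangeAux (u : W) :
    ((TensorProduct.assoc L (L ⊗[K] A) (L ⊗[K] A) (L ⊗[K] W)).toLinearMap ∘ₗ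
        (TensorProduct.mk L _ _).flip (1 ⊗ₜ u)).restrictScalars K ∘ₗ baseChangeAux K A A L =
      baseChangeAux₂ K A W L ∘ₗ (TensorProduct.assoc K A A W).toLinearMap ∘ₗ
        (TensorProduct.mk K _ _).flip u :=
  TensorProduct.ext' fun b c => by
    simp [baseChangeAux_tmul, baseChangeAux₂_tmul]

theorem assoc_comul_baseChangeAux :
    ((TensorProduct.assoc L (L ⊗[K] A) (L ⊗[K] A) (L ⊗[K] W)).toLinearMap ∘ₗ
        (Coalgebra.comul (R := L) (A := L ⊗[K] A)).rTensor (L ⊗[K] W)).restrictScalars K ∘ₗ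
          baseChangeAux K A W L =
      baseChangeAux₂ K A W L ∘ₗ (TensorProduct.assoc K A A W).toLinearMap ∘ₗ
        (Coalgebra.comul (R := K) (A := A)).rTensor W :=
  TensorProduct.ext' fun a u => by
    have h := LinearMap.congr_fun (assoc_baseChangeAux (K := K) (A := A) L u)
      (Coalgebra.comul (R := K) a)
    refine Eq.trans ?_ h
    rw [LinearMap.comp_apply, baseChangeAux_tmul, LinearMap.comp_apply, ← comul_one_tmul]
    rfl

theorem lTensor_baseChangeAux (f : W →ₗ[K] A ⊗[K] W) :
    (((TensorProduct.AlgebraTensorModule.distribBaseChange K L A W).toLinearMap ∘ₗ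
        f.baseChange L).lTensor (L ⊗[K] A)).restrictScalars K ∘ₗ baseChangeAux K A W L =
      baseChangeAux₂ K A W L ∘ₗ f.lTensor A :=
  TensorProduct.ext' fun a u => by
    simp [baseChangeAux₂_tmul, baseChangeAux]

theorem counit_baseChangeAux :
    ((Coalgebra.counit (R := L) (A := L ⊗[K] A)).rTensor (L ⊗[K] W)).restrictScalars K ∘ₗ
          baseChangeAux K A W L =
      (TensorProduct.mk L L (L ⊗[K] W) 1).restrictScalars K ∘ₗ TensorProduct.mk K L W 1 ∘ₗ
        (TensorProduct.lid K W).toLinearMap ∘ₗ (Coalgebra.counit (R := K) (A := A)).rTensor W :=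
  TensorProduct.ext' fun a u => by
    simp only [LinearMap.comp_apply, LinearMap.restrictScalars_apply, baseChangeAux_tmul,
      LinearMap.rTensor_tmul, TensorProduct.counit_tmul, LinearEquiv.coe_coe,
      TensorProduct.lid_tmul, TensorProduct.mk_apply, TensorProduct.tmul_smul]
    simp [TensorProduct.smul_tmul']

/-- The base extension `W_L = L ⊗ W`, a representation of `G_L = Spec (L ⊗ A)`:
if `ρ w = ∑ aᵢ ⊗ wᵢ` then `l ⊗ w ↦ ∑ (l ⊗ aᵢ) ⊗ (1 ⊗ wᵢ)`. -/
def baseChange (ρ : Coaction K A W) : Coaction L (L ⊗[K] A) (L ⊗[K] W) where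
  map := (TensorProduct.AlgebraTensorModule.distribBaseChange K L A W).toLinearMap ∘ₗ
    ρ.map.baseChange L
  coassoc := by
    apply TensorProduct.AlgebraTensorModule.curry_injective
    ext w
    have h1 := congrArg (baseChangeAux₂ K A W L) (LinearMap.congr_fun ρ.coassoc w)
    have h2 := LinearMap.congr_fun (assoc_comul_baseChangeAux (K := K) (A := A) (W := W) L)
      (ρ.map w)
    have h3 := LinearMap.congr_fun (lTensor_baseChangeAux L ρ.map) (ρ.map w)
    exact (h2.trans h1).trans h3.symm
  counit := by
    apply TensorProduct.AlgebraTensorModule.curry_injective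
    ext w
    have h1 := LinearMap.congr_fun ρ.counit w
    have h2 := LinearMap.congr_fun (counit_baseChangeAux (K := K) (A := A) (W := W) L) (ρ.map w)
    refine h2.trans ?_
    simp only [LinearMap.comp_apply] at h1 ⊢
    rw [h1]
    simp

/-- `m` is the multiplicity with which irreducible representations of `G_L` occur in `W_L`:
every isotypic component of `W_L` is the direct sum of `m` copies of an irreducible
representation. -/
def IsMultiplicity (ρ : Coaction K A W) (m : ℕ) : Prop :=
  ∀ (V : Submodule L (L ⊗[K] W)) (hV : (ρ.baseChange L).IsStable V),
    ((ρ.baseChange L).restrict V hV).IsIrreducible →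
      (ρ.baseChange L).IsotypicComponentIsPower ((ρ.baseChange L).restrict V hV) m

/-- The number `m(W, L/K)`.  (It is `0` if `W_L` contains no irreducible subrepresentation, or if
its isotypic components do not have a common finite multiplicity.) -/
def multiplicity (ρ : Coaction K A W) : ℕ :=
  sInf {m | ρ.IsMultiplicity L m}

end BaseChange

section Conjugate

variable {K A : Type*} [Field K] [CommRing A] [HopfAlgebra K A]
variable {L : Type*} [Field L] [Algebra K L]

/-- The `L`-vector space `γ_* V`: the abelian group `V` with scalar multiplication
`(l, v) ↦ γ l • v`. -/
def Conj (_γ : L ≃ₐ[K] L) (V : Type*) : Type _ := V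

instance (γ : L ≃ₐ[K] L) (V : Type*) [AddCommGroup V] : AddCommGroup (Conj γ V) :=
  inferInstanceAs (AddCommGroup V)

instance (γ : L ≃ₐ[K] L) (V : Type*) [AddCommGroup V] [Module L V] : Module L (Conj γ V) :=
  Module.compHom V (γ : L →+* L)

/-- The identity `V → γ_* V`, which is `γ⁻¹`-semilinear. -/
def toConj (γ : L ≃ₐ[K] L) (V : Type*) [AddCommGroup V] [Module L V] :
    V →ₛₗ[((γ.symm : L ≃ₐ[K] L) : L →+* L)] Conj γ V where
  toFun v := v
  map_add' _ _ := rfl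
  map_smul' l v := by
    change l • v = γ (γ.symm l) • v
    rw [γ.apply_symm_apply]

/-- The identity `γ_* V → V`, which is `γ`-semilinear. -/
def ofConj (γ : L ≃ₐ[K] L) (V : Type*) [AddCommGroup V] [Module L V] :
    Conj γ V →ₛₗ[(γ : L →+* L)] V where
  toFun v := v
  map_add' _ _ := rfl
  map_smul' _ _ := rfl

/-- The operation of `γ` on `A_L = L ⊗ A` through the first factor. -/
def galMap (A : Type*) [CommRing A] [HopfAlgebra K A] (γ : L ≃ₐ[K] L) :
    L ⊗[K] A →ₛₗ[(γ : L →+* L)] L ⊗[K] A where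
  toFun := Algebra.TensorProduct.map (γ : L →ₐ[K] L) (AlgHom.id K A)
  map_add' := map_add _
  map_smul' l x := by
    induction x using TensorProduct.induction_on with
    | zero => simp
    | add x y hx hy => simp only [smul_add, map_add, hx, hy]
    | tmul b c => simp [TensorProduct.smul_tmul']

instance (γ : L ≃ₐ[K] L) :
    RingHomCompTriple (γ : L →+* L) ((γ.symm : L ≃ₐ[K] L) : L →+* L) (RingHom.id L) :=
  ⟨by ext x; simp⟩

theorem galMap_tmul (γ : L ≃ₐ[K] L) (l : L) (a : A) :
    galMap A γ (l ⊗ₜ a) = γ l ⊗ₜ a := rfl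

theorem comul_galMap (γ : L ≃ₐ[K] L) (x : L ⊗[K] A) :
    Coalgebra.comul (R := L) (galMap A γ x) =
      TensorProduct.map (galMap A γ) (galMap A γ) (Coalgebra.comul (R := L) x) := by
  induction x using TensorProduct.induction_on with
  | zero => simp
  | add x y hx hy => simp only [map_add, hx, hy]
  | tmul l a =>
    rw [galMap_tmul, TensorProduct.comul_tmul, TensorProduct.comul_tmul]
    generalize Coalgebra.comul (R := K) a = y
    induction y using TensorProduct.induction_on with
    | zero => simp
    | add x y hx hy => simp only [map_add, TensorProduct.tmul_add, hx, hy]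
    | tmul b c => simp [galMap_tmul]

theorem counit_galMap (γ : L ≃ₐ[K] L) (x : L ⊗[K] A) :
    Coalgebra.counit (R := L) (galMap A γ x) = γ (Coalgebra.counit (R := L) x) := by
  induction x using TensorProduct.induction_on with
  | zero => simp
  | add x y hx hy => simp only [map_add, hx, hy]
  | tmul l a => simp [galMap_tmul]

/-- The map `a ⊗ v ↦ γ⁻¹ a ⊗ v`. -/
def conjAux (γ : L ≃ₐ[K] L) (A : Type*) [CommRing A] [HopfAlgebra K A]
    (V : Type*) [AddCommGroup V] [Module L V] :
    (L ⊗[K] A) ⊗[L] V →ₛₗ[((γ.symm : L ≃ₐ[K] L) : L →+* L)] (L ⊗[K] A) ⊗[L] Conj γ V :=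
  TensorProduct.map (galMap A γ.symm) (toConj γ V)

/-- The structure map of the conjugate representation. -/
def conjMap {V : Type*} [AddCommGroup V] [Module L V] (γ : L ≃ₐ[K] L)
    (ρ : V →ₗ[L] (L ⊗[K] A) ⊗[L] V) : Conj γ V →ₗ[L] (L ⊗[K] A) ⊗[L] Conj γ V :=
  (conjAux γ A V).comp (ρ.comp (ofConj γ V))

theorem assoc_comul_conjAux {V : Type*} [AddCommGroup V] [Module L V] (γ : L ≃ₐ[K] L) :
    ((TensorProduct.assoc L (L ⊗[K] A) (L ⊗[K] A) (Conj γ V)).toLinearMap ∘ₗ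
        (Coalgebra.comul (R := L) (A := L ⊗[K] A)).rTensor (Conj γ V)).comp (conjAux γ A V) =
      (TensorProduct.map (galMap A γ.symm) (conjAux γ A V)).comp
        ((TensorProduct.assoc L (L ⊗[K] A) (L ⊗[K] A) V).toLinearMap ∘ₗ
          (Coalgebra.comul (R := L) (A := L ⊗[K] A)).rTensor V) := by
  have h : ∀ v : V, ((TensorProduct.assoc L (L ⊗[K] A) (L ⊗[K] A) (Conj γ V)).toLinearMap ∘ₗ
        (TensorProduct.mk L _ _).flip (toConj γ V v)).comp
          (TensorProduct.map (galMap A γ.symm) (galMap A γ.symm)) =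
      (TensorProduct.map (galMap A γ.symm) (conjAux γ A V)).comp
        ((TensorProduct.assoc L (L ⊗[K] A) (L ⊗[K] A) V).toLinearMap ∘ₗ
          (TensorProduct.mk L _ _).flip v) := fun v => TensorProduct.ext' fun x y => by
    simp [conjAux]
  refine TensorProduct.ext' fun a v => ?_
  refine Eq.trans ?_ (LinearMap.congr_fun (h v) (Coalgebra.comul (R := L) a))
  simp [conjAux, comul_galMap]

theorem lTensor_conjAux {V : Type*} [AddCommGroup V] [Module L V] (γ : L ≃ₐ[K] L)
    (ρ : V →ₗ[L] (L ⊗[K] A) ⊗[L] V) :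
    ((conjMap γ ρ).lTensor (L ⊗[K] A)).comp (conjAux γ A V) =
      (TensorProduct.map (galMap A γ.symm) (conjAux γ A V)).comp (ρ.lTensor (L ⊗[K] A)) :=
  TensorProduct.ext' fun _ _ => rfl

theorem counit_conjAux {V : Type*} [AddCommGroup V] [Module L V] (γ : L ≃ₐ[K] L)
    (x : (L ⊗[K] A) ⊗[L] V) :
    TensorProduct.lid L (Conj γ V)
        ((Coalgebra.counit (R := L) (A := L ⊗[K] A)).rTensor (Conj γ V) (conjAux γ A V x)) =
      toConj γ V (TensorProduct.lid L V
        ((Coalgebra.counit (R := L) (A := L ⊗[K] A)).rTensor V x)) := by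
  induction x using TensorProduct.induction_on with
  | zero => simp
  | add x y hx hy => simp only [map_add, hx, hy]
  | tmul a v => simp [conjAux, counit_galMap]

/-- The conjugate representation `γ_* V`: the structure map is characterized by
`(γ ⊗ id) ∘ ρ_{γ_* V} = ρ_V`, that is, if `ρ_V v = ∑ aᵢ ⊗ vᵢ` then
`ρ_{γ_* V} v = ∑ γ⁻¹ aᵢ ⊗ vᵢ`. -/
def conj {V : Type*} [AddCommGroup V] [Module L V] (γ : L ≃ₐ[K] L)
    (ρ : Coaction L (L ⊗[K] A) V) : Coaction L (L ⊗[K] A) (Conj γ V) where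
  map := conjMap γ ρ.map
  coassoc := by
    ext v
    have h1 := LinearMap.congr_fun (assoc_comul_conjAux (A := A) (V := V) γ)
      (ρ.map (ofConj γ V v))
    have h2 := LinearMap.congr_fun ρ.coassoc (ofConj γ V v)
    have h3 := LinearMap.congr_fun (lTensor_conjAux γ ρ.map) (ρ.map (ofConj γ V v))
    exact (h1.trans (congrArg (TensorProduct.map (galMap A γ.symm) (conjAux γ A V)) h2)).trans
      h3.symm
  counit := by
    ext v
    have h2 := LinearMap.congr_fun ρ.counit (ofConj γ V v)
    have h1 := counit_conjAux γ (ρ.map (ofConj γ V v))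
    simp only [LinearMap.comp_apply] at h2
    rw [h2] at h1
    apply (TensorProduct.lid L (Conj γ V)).injective
    refine h1.trans ?_
    simp
    rfl

end Conjugate

end Coaction

end

/-! The heart of the matter is that the ring `End_G(W)` is commutative (`endomorphisms_comm`); the
rest is Galois descent and semisimple algebra.

The sum of the Γ-conjugates of a nonzero subrepresentation of `W_L` is Γ-stable, so it contains a
nonzero rational vector, and by irreducibility of `W` it is all of `W_L`. Hence `W_L` is a sum of
conjugates of one irreducible subrepresentation and is semisimple. An endomorphism of `W_L` lies in
the `L`-span of `End_G(W)`, so `End(W_L)` is commutative too. In a semisimple module with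
commutative endomorphism ring isomorphic submodules coincide: isotypic components are irreducible,
and any irreducible subrepresentation is a conjugate of any other.

For the commutativity, pass to an algebraic closure `F`. In characteristic 0 the trace form of a
finite commutative Hopf algebra is nondegenerate, so the algebra is reduced (Cartier), and the
points of `G` over `F` span all functionals. They form a finite subgroup of `SL(2, F)`, with natural
character `t` satisfying `t(g⁻¹) = t(g)`. Its McKay graph, with the irreducible characters as
vertices and the multiplicities of `χ'` in `tχ` as adjacency matrix, is symmetric and connected, and
the dimensions form an eigenvector for the eigenvalue 2. An edge count, without classification
(`const_or_exists_unique_walk`), gives an alternative: all irreducible characters are linear, or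
each of them is reached from the trivial one by exactly one walk of some length `n`, that is, occurs
exactly once in the `n`-th tensor power.

In the linear case all operators from the coaction commute, and on a given nonzero vector each
endomorphism of `W` agrees with such an operator. In the other case the tensor powers are defined
over `K`, so a nonzero map from `W_F` to one of them yields an embedding of `W_F` into it
(`exists_injective_intertwiningMap`). An irreducible `S ⊆ W_F` occurring once in that power can then
be moved by an endomorphism only by a scalar. Such `S` span `W_F`, so endomorphisms commute. -/

noncomputable section

/-! ### Detecting tensors by functionals on one factor. -/

section TensorFunctionals

variable {k M V : Type*} [Field k] [AddCommGroup M] [Module k M] [AddCommGroup V] [Module k V]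

theorem TensorProduct.eq_zero_of_forall_dual_rTensor {x : M ⊗[k] V}
    (h : ∀ φ : M →ₗ[k] k, φ.rTensor V x = 0) : x = 0 := by
  classical
  let b := Module.Basis.ofVectorSpace k M
  apply (TensorProduct.equivFinsuppOfBasisLeft (N := V) b).injective
  rw [map_zero]
  ext i
  have h2 : ∀ y : M ⊗[k] V, TensorProduct.equivFinsuppOfBasisLeft (N := V) b y i =
      TensorProduct.lid k V ((b.coord i).rTensor V y) := fun y => by
    induction y using TensorProduct.induction_on with
    | zero => simp
    | add x y hx hy => simp only [map_add, Finsupp.add_apply, hx, hy]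
    | tmul m v => simp
  rw [h2, h]; simp

theorem TensorProduct.ext_of_forall_dual_rTensor {x y : M ⊗[k] V}
    (h : ∀ φ : M →ₗ[k] k, φ.rTensor V x = φ.rTensor V y) : x = y :=
  sub_eq_zero.1 (eq_zero_of_forall_dual_rTensor fun φ => by rw [map_sub, h, sub_self])

/-- By right exactness the range is the kernel of `M ⊗ V → M ⊗ (V ⧸ U)`, where functionals on `M`
separate points. This turns stability under a coaction into invariance under operators. -/
theorem TensorProduct.mem_range_lTensor_subtype_iff (U : Submodule k V) (x : M ⊗[k] V) :
    x ∈ LinearMap.range (U.subtype.lTensor M) ↔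
      ∀ φ : M →ₗ[k] k, TensorProduct.lid k V (φ.rTensor V x) ∈ U := by
  constructor
  · rintro ⟨y, rfl⟩ φ
    have : TensorProduct.lid k V (φ.rTensor V (U.subtype.lTensor M y)) =
        U.subtype (TensorProduct.lid k U (φ.rTensor U y)) := by
      induction y using TensorProduct.induction_on with
      | zero => simp
      | add x y hx hy => simp only [map_add, hx, hy]
      | tmul m v => simp
    rw [this]
    exact Subtype.coe_prop _
  · intro h
    have hex : Function.Exact U.subtype U.mkQ := by
      rw [LinearMap.exact_iff]; simp
    refine ((lTensor_exact M hex U.mkQ_surjective) x).1 ?_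
    refine eq_zero_of_forall_dual_rTensor fun φ => ?_
    apply (TensorProduct.lid k (V ⧸ U)).injective
    have : ∀ y : M ⊗[k] V, TensorProduct.lid k (V ⧸ U) (φ.rTensor _ (U.mkQ.lTensor M y)) =
        U.mkQ (TensorProduct.lid k V (φ.rTensor V y)) := fun y => by
      induction y using TensorProduct.induction_on with
      | zero => simp
      | add x y hx hy => simp only [map_add, hx, hy]
      | tmul m v => simp
    rw [this, map_zero, Submodule.mkQ_apply, Submodule.Quotient.mk_eq_zero]
    exact h φ

end TensorFunctionals

/-! ### The operators on a comodule attached to functionals on the coordinate ring. -/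

section Operators

variable {K A W X : Type*} [Field K] [AddCommGroup A] [Module K A]
  [AddCommGroup W] [Module K W] [AddCommGroup X] [Module K X]

/-- The operator `w ↦ ∑ φ(aᵢ) wᵢ` attached to a functional `φ` and a map `ρ w = ∑ aᵢ ⊗ wᵢ`. -/
def coactOp (ρ : W →ₗ[K] A ⊗[K] W) (φ : A →ₗ[K] K) : W →ₗ[K] W :=
  (TensorProduct.lid K W).toLinearMap ∘ₗ φ.rTensor W ∘ₗ ρ

theorem coactOp_apply (ρ : W →ₗ[K] A ⊗[K] W) (φ : A →ₗ[K] K) (w : W) :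
    coactOp ρ φ w = TensorProduct.lid K W (φ.rTensor W (ρ w)) := rfl

/-- Since functionals on `A` separate the points of `A ⊗ X`, comodule maps are exactly the linear
maps commuting with all operators. -/
theorem coact_comm_iff (ρ : W →ₗ[K] A ⊗[K] W) (τ : X →ₗ[K] A ⊗[K] X) (f : W →ₗ[K] X) :
    τ ∘ₗ f = f.lTensor A ∘ₗ ρ ↔ ∀ φ w, f (coactOp ρ φ w) = coactOp τ φ (f w) := by
  have key : ∀ (φ : A →ₗ[K] K) (y : A ⊗[K] W),
      TensorProduct.lid K X (φ.rTensor X (f.lTensor A y)) =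
        f (TensorProduct.lid K W (φ.rTensor W y)) := fun φ y => by
    induction y using TensorProduct.induction_on with
    | zero => simp
    | add x y hx hy => simp only [map_add, hx, hy]
    | tmul m v => simp
  constructor
  · intro h φ w
    have := LinearMap.congr_fun h w
    simp only [LinearMap.comp_apply] at this
    rw [coactOp_apply, coactOp_apply, this, key]
  · intro h
    ext w
    refine TensorProduct.ext_of_forall_dual_rTensor fun φ => (TensorProduct.lid K X).injective ?_
    rw [LinearMap.comp_apply, LinearMap.comp_apply, key]
    exact (h φ w).symm

variable (L : Type*) [Field L] [Algebra K L]

/-- The `L`-linear operator on `L ⊗ W` attached to a `K`-linear map `ψ : A → L`: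
`1 ⊗ w ↦ ∑ ψ(aᵢ) ⊗ wᵢ`. -/
def coactOpL (ρ : W →ₗ[K] A ⊗[K] W) (ψ : A →ₗ[K] L) : L ⊗[K] W →ₗ[L] L ⊗[K] W :=
  LinearMap.liftBaseChange L (ψ.rTensor W ∘ₗ ρ)

variable {L}

theorem coactOpL_tmul (ρ : W →ₗ[K] A ⊗[K] W) (ψ : A →ₗ[K] L) (l : L) (w : W) :
    coactOpL L ρ ψ (l ⊗ₜ w) = l • ψ.rTensor W (ρ w) := by
  simp [coactOpL]

theorem coactOpL_linearMap_tmul (ρ : W →ₗ[K] A ⊗[K] W) (φ : A →ₗ[K] K) (l : L) (w : W) :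
    coactOpL L ρ (Algebra.linearMap K L ∘ₗ φ) (l ⊗ₜ w) = l ⊗ₜ coactOp ρ φ w := by
  rw [coactOpL_tmul, coactOp_apply]
  generalize ρ w = y
  induction y using TensorProduct.induction_on with
  | zero => simp
  | add x y hx hy => simp only [map_add, TensorProduct.tmul_add, smul_add, hx, hy]
  | tmul a v =>
    simp [TensorProduct.smul_tmul', Algebra.smul_def, mul_comm]

theorem coactOpL_add (ρ : W →ₗ[K] A ⊗[K] W) (ψ ψ' : A →ₗ[K] L) :
    coactOpL L ρ (ψ + ψ') = coactOpL L ρ ψ + coactOpL L ρ ψ' := by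
  apply TensorProduct.AlgebraTensorModule.curry_injective
  ext w
  simp [coactOpL_tmul, LinearMap.rTensor_add]

theorem coactOpL_smul (ρ : W →ₗ[K] A ⊗[K] W) (l : L) (ψ : A →ₗ[K] L) :
    coactOpL L ρ (l • ψ) = l • coactOpL L ρ ψ := by
  apply TensorProduct.AlgebraTensorModule.curry_injective
  ext w
  simp only [TensorProduct.AlgebraTensorModule.curry_apply, TensorProduct.curry_apply,
    LinearMap.coe_restrictScalars, coactOpL_tmul, one_smul,
    LinearMap.smul_apply]
  generalize ρ w = y
  induction y using TensorProduct.induction_on with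
  | zero => simp
  | add x y hx hy => simp only [map_add, smul_add, hx, hy]
  | tmul a v => simp [TensorProduct.smul_tmul']

end Operators

/-! ### Stability, isomorphism and base change in terms of operators. -/

namespace Coaction

section Basic

variable {K A V V' : Type*} [Field K] [AddCommGroup A] [Module K A] [Coalgebra K A]
  [AddCommGroup V] [Module K V] [AddCommGroup V'] [Module K V']

theorem isStable_iff (ρ : Coaction K A V) (U : Submodule K V) :
    ρ.IsStable U ↔ ∀ φ, ∀ u ∈ U, coactOp ρ.map φ u ∈ U := by
  simp only [IsStable, TensorProduct.mem_range_lTensor_subtype_iff, coactOp_apply]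
  exact ⟨fun h φ u hu => h u hu φ, fun h u hu φ => h φ u hu⟩

theorem iso_iff (ρ : Coaction K A V) (ρ' : Coaction K A V') :
    ρ.Iso ρ' ↔ ∃ e : V ≃ₗ[K] V', ∀ φ v, e (coactOp ρ.map φ v) = coactOp ρ'.map φ (e v) :=
  exists_congr fun e => coact_comm_iff ρ.map ρ'.map e.toLinearMap

theorem coe_coactOp_restrict (ρ : Coaction K A V) (U : Submodule K V) (hU : ρ.IsStable U)
    (φ : A →ₗ[K] K) (u : U) :
    (coactOp (ρ.restrict U hU).map φ u : V) = coactOp ρ.map φ u :=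
  (coact_comm_iff (ρ.restrict U hU).map ρ.map U.subtype).1
    (ρ.lTensor_comp_restrictMap U hU).symm φ u

theorem coactOp_counit (ρ : Coaction K A V) (v : V) : coactOp ρ.map Coalgebra.counit v = v := by
  have := LinearMap.congr_fun ρ.counit v
  simp only [LinearMap.comp_apply] at this
  rw [coactOp_apply, this]; simp

end Basic

section BaseChange

variable {K A W : Type*} [Field K] [CommRing A] [HopfAlgebra K A] [AddCommGroup W] [Module K W]
variable {L : Type*} [Field L] [Algebra K L]

theorem coactOp_baseChange (ρ : Coaction K A W) (φ : L ⊗[K] A →ₗ[L] L) :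
    coactOp (ρ.baseChange L).map φ =
      coactOpL L ρ.map (φ.restrictScalars K ∘ₗ TensorProduct.mk K L A 1) := by
  apply TensorProduct.AlgebraTensorModule.curry_injective
  ext w
  simp only [TensorProduct.AlgebraTensorModule.curry_apply, TensorProduct.curry_apply,
    LinearMap.coe_restrictScalars, coactOpL_tmul, one_smul,
    coactOp_apply, baseChange, LinearMap.comp_apply, LinearMap.baseChange_tmul]
  generalize ρ.map w = y
  induction y using TensorProduct.induction_on with
  | zero => simp
  | add x y hx hy => simp only [map_add, TensorProduct.tmul_add, hx, hy]
  | tmul a v => simp [TensorProduct.smul_tmul']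

/-- An `L`-linear functional on `L ⊗ A` is the same as a `K`-linear map `A → L`. -/
theorem forall_coactOp_baseChange (ρ : Coaction K A W)
    {P : (L ⊗[K] W →ₗ[L] L ⊗[K] W) → Prop} :
    (∀ φ, P (coactOp (ρ.baseChange L).map φ)) ↔ ∀ ψ, P (coactOpL L ρ.map ψ) := by
  refine ⟨fun h ψ => ?_, fun h φ => by rw [coactOp_baseChange]; exact h _⟩
  have := h (LinearMap.liftBaseChange L ψ)
  rw [coactOp_baseChange] at this
  convert this
  ext a; simp

theorem isStable_baseChange_iff (ρ : Coaction K A W) (U : Submodule L (L ⊗[K] W)) :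
    (ρ.baseChange L).IsStable U ↔ ∀ ψ, ∀ u ∈ U, coactOpL L ρ.map ψ u ∈ U := by
  rw [isStable_iff]
  exact ρ.forall_coactOp_baseChange (P := fun T => ∀ u ∈ U, T u ∈ U)

theorem coactOpL_counit (ρ : Coaction K A W) :
    coactOpL L ρ.map (Algebra.linearMap K L ∘ₗ Coalgebra.counit) = LinearMap.id := by
  apply TensorProduct.AlgebraTensorModule.curry_injective
  ext w
  simp [coactOpL_linearMap_tmul, coactOp_counit]

/-- This is coassociativity. The order is reversed because in a left comodule the functional on the
first leg of the comultiplication acts first. -/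
theorem coactOpL_convMul (ρ : Coaction K A W) (f g : WithConv (A →ₗ[K] L)) :
    coactOpL L ρ.map (f * g).ofConv = coactOpL L ρ.map g.ofConv ∘ₗ coactOpL L ρ.map f.ofConv := by
  apply TensorProduct.AlgebraTensorModule.curry_injective
  ext w
  simp only [TensorProduct.AlgebraTensorModule.curry_apply, TensorProduct.curry_apply,
    LinearMap.coe_restrictScalars, coactOpL_tmul, one_smul,
    LinearMap.comp_apply]
  have h := LinearMap.congr_fun ρ.coassoc w
  simp only [LinearMap.comp_apply] at h
  let Φ : A ⊗[K] (A ⊗[K] W) →ₗ[K] L ⊗[K] W :=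
    (LinearMap.mul' K L).rTensor W ∘ₗ (TensorProduct.assoc K L L W).symm.toLinearMap ∘ₗ
      TensorProduct.map f.ofConv (g.ofConv.rTensor W)
  have h1 : ∀ y : A ⊗[K] W, (f * g).ofConv.rTensor W y =
      Φ (TensorProduct.assoc K A A W ((Coalgebra.comul (R := K) (A := A)).rTensor W y)) :=
    fun y => by
      induction y using TensorProduct.induction_on with
      | zero => simp
      | add x y hx hy => simp only [map_add, hx, hy]
      | tmul a v =>
        simp only [LinearMap.rTensor_tmul, LinearMap.convMul_def, LinearMap.comp_apply]
        generalize Coalgebra.comul (R := K) a = z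
        induction z using TensorProduct.induction_on with
        | zero => simp
        | add x y hx hy => simp only [map_add, TensorProduct.add_tmul, hx, hy]
        | tmul b c => simp [Φ]
  have h2 : ∀ y : A ⊗[K] W, coactOpL L ρ.map g.ofConv (f.ofConv.rTensor W y) =
      Φ (ρ.map.lTensor A y) := fun y => by
    induction y using TensorProduct.induction_on with
    | zero => simp
    | add x y hx hy => simp only [map_add, hx, hy]
    | tmul a v =>
      simp only [LinearMap.rTensor_tmul, LinearMap.lTensor_tmul, coactOpL_tmul]
      generalize ρ.map v = z
      induction z using TensorProduct.induction_on with
      | zero => simp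
      | add x y hx hy => simp only [map_add, smul_add, TensorProduct.tmul_add, hx, hy]
      | tmul b c => simp [Φ, TensorProduct.smul_tmul']
  rw [h1, h2]
  exact congrArg Φ h

end BaseChange

end Coaction

/-! ### Cartier's theorem for finite Hopf algebras, through the trace form. -/

namespace HopfAlgebra

open Coalgebra

section Trace

variable {F B : Type*} [Field F] [CommRing B] [HopfAlgebra F B]

/-- In Sweedler notation, `∑ S(b₁) b₂ ⊗ b₃ = 1 ⊗ b`. -/
theorem lift_antipode_comul (b : B) :
    (LinearMap.mul' F B).rTensor B ((TensorProduct.assoc F B B B).symm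
      (TensorProduct.map (antipode F) (comul (R := F)) (comul (R := F) b))) = 1 ⊗ₜ b := by
  have h1 : TensorProduct.map (antipode F) (comul (R := F)) (comul (R := F) b) =
      (antipode F (A := B)).rTensor (B ⊗[F] B) (TensorProduct.assoc F B B B
        ((comul (R := F)).rTensor B (comul (R := F) b))) := by
    rw [Coalgebra.coassoc_apply]
    generalize comul (R := F) b = z
    induction z using TensorProduct.induction_on with
    | zero => simp
    | add x y hx hy => simp only [map_add, hx, hy]
    | tmul x y => simp
  have h2 : ∀ z : B ⊗[F] B, (LinearMap.mul' F B).rTensor B ((TensorProduct.assoc F B B B).symm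
      ((antipode F (A := B)).rTensor (B ⊗[F] B) (TensorProduct.assoc F B B B
        ((comul (R := F)).rTensor B z)))) =
      (Algebra.linearMap F B).rTensor B ((counit (R := F)).rTensor B z) := fun z => by
    induction z using TensorProduct.induction_on with
    | zero => simp
    | add x y hx hy => simp only [map_add, hx, hy]
    | tmul x y =>
      simp only [LinearMap.rTensor_tmul, Algebra.linearMap_apply]
      rw [← mul_antipode_rTensor_comul_apply]
      generalize comul (R := F) x = w
      induction w using TensorProduct.induction_on with
      | zero => simp
      | add x y hx hy => simp only [map_add, TensorProduct.add_tmul, hx, hy]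
      | tmul x y => simp
  rw [h1, h2, Coalgebra.rTensor_counit_comul]
  simp

variable (F B) in
/-- The shear map `x ⊗ y ↦ (x ⊗ 1) Δ(y)`. -/
def shear : B ⊗[F] B →ₐ[B] B ⊗[F] B :=
  Algebra.TensorProduct.lift (Algebra.ofId B (B ⊗[F] B)) (Bialgebra.comulAlgHom F B)
    fun _ _ => Commute.all _ _

theorem shear_tmul (x y : B) : shear F B (x ⊗ₜ y) = (x ⊗ₜ 1) * comul (R := F) y := by
  simp [shear, Algebra.ofId_apply]

/-- Exhibits a preimage of `1 ⊗ b`; by `B`-linearity the shear map is surjective, hence bijective in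
finite dimension. -/
theorem shear_antipode_comul (b : B) :
    shear F B ((antipode F (A := B)).rTensor B (comul (R := F) b)) = 1 ⊗ₜ b := by
  rw [← lift_antipode_comul]
  generalize comul (R := F) b = z
  induction z using TensorProduct.induction_on with
  | zero => simp
  | add x y hx hy => simp only [map_add, hx, hy]
  | tmul x y =>
    simp only [LinearMap.rTensor_tmul, shear_tmul, TensorProduct.map_tmul]
    generalize comul (R := F) y = w
    induction w using TensorProduct.induction_on with
    | zero => simp
    | add x y hx hy => simp only [map_add, TensorProduct.tmul_add, mul_add, hx, hy]
    | tmul x y => simp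

theorem shear_surjective : Function.Surjective (shear F B) := by
  intro z
  induction z using TensorProduct.induction_on with
  | zero => exact ⟨0, map_zero _⟩
  | add x y hx hy =>
    obtain ⟨u, rfl⟩ := hx
    obtain ⟨v, rfl⟩ := hy
    exact ⟨u + v, map_add _ _ _⟩
  | tmul x y =>
    refine ⟨x • (antipode F (A := B)).rTensor B (comul (R := F) y), ?_⟩
    rw [map_smul, shear_antipode_comul, TensorProduct.smul_tmul', smul_eq_mul, mul_one]

variable [Module.Finite F B]

theorem shear_bijective : Function.Bijective (shear F B) :=
  ⟨(LinearMap.injective_iff_surjective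
    (f := (shear F B).toLinearMap.restrictScalars F)).2 shear_surjective, shear_surjective⟩

theorem trace_tmul (x y : B) :
    Algebra.trace B (B ⊗[F] B) (x ⊗ₜ y) = Algebra.trace F B y • x := by
  have h1 : x ⊗ₜ[F] y = x • (1 ⊗ₜ[F] y) := by
    rw [TensorProduct.smul_tmul', smul_eq_mul, mul_one]
  have h2 : Algebra.lmul B (B ⊗[F] B) (1 ⊗ₜ y) = (Algebra.lmul F B y).baseChange B := by
    apply TensorProduct.AlgebraTensorModule.curry_injective
    ext z
    simp
  rw [h1, map_smul, Algebra.trace_apply, h2, LinearMap.trace_baseChange, Algebra.trace_apply,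
    smul_eq_mul, Algebra.smul_def, mul_comm]

/-- The trace form of a finite-dimensional commutative Hopf algebra is an integral. -/
theorem lTensor_trace_comul (b : B) :
    TensorProduct.rid F B ((Algebra.trace F B).lTensor B (comul (R := F) b)) =
      Algebra.trace F B b • 1 := by
  have h1 : ∀ z : B ⊗[F] B, TensorProduct.rid F B ((Algebra.trace F B).lTensor B z) =
      Algebra.trace B (B ⊗[F] B) z := fun z => by
    induction z using TensorProduct.induction_on with
    | zero => simp
    | add x y hx hy => simp only [map_add, hx, hy]
    | tmul x y => simp [trace_tmul]
  rw [h1]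
  -- The shear map is a `B`-algebra automorphism taking `1 ⊗ b` to `Δ(b)`, so both have the same
  -- trace over the left factor.
  have h2 := Algebra.trace_eq_of_algEquiv (AlgEquiv.ofBijective (shear F B) shear_bijective)
    (1 ⊗ₜ b)
  rw [AlgEquiv.coe_ofBijective, shear_tmul, trace_tmul, ← Algebra.TensorProduct.one_def,
    one_mul] at h2
  exact h2

/-- The radical `R` of the trace form is an ideal, and `Δ(R) ⊆ B ⊗ R` because the trace is an
integral. For `r ∈ R` the antipode identity puts `ε(r)·1` in `R`; its trace is `ε(r) dim B`, so
`ε(r) = 0` in characteristic 0. Then `a = (id ⊗ ε)Δ(a) = 0`. -/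
theorem eq_zero_of_forall_trace_mul [CharZero F] {a : B}
    (ha : ∀ b, Algebra.trace F B (a * b) = 0) : a = 0 := by
  let Λ : B ⊗[F] B →ₗ[F] B :=
    (TensorProduct.rid F B).toLinearMap ∘ₗ (Algebra.trace F B).lTensor B
  have hΛ : ∀ (s : B) z, Λ ((s ⊗ₜ 1) * z) = s * Λ z := fun s z => by
    induction z using TensorProduct.induction_on with
    | zero => simp
    | add x y hx hy => simp only [mul_add, map_add, hx, hy]
    | tmul x y => simp [Λ]
  have hint : ∀ b, Λ (comul (R := F) b) = Algebra.trace F B b • 1 := lTensor_trace_comul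
  let R : Submodule F B :=
    { carrier := {a | ∀ b, Algebra.trace F B (a * b) = 0}
      add_mem' := fun hx hy b => by rw [add_mul, map_add, hx b, hy b, add_zero]
      zero_mem' := fun b => by rw [zero_mul, map_zero]
      smul_mem' := fun c x hx b => by rw [smul_mul_assoc, map_smul, hx b, smul_zero] }
  -- Writing `1 ⊗ b = ∑ (S(b₁) ⊗ 1) Δ(b₂)` turns the left side into `∑ S(b₁) tr(a b₂)`.
  have h1 : ∀ a ∈ R, ∀ b, Λ (comul (R := F) a * (1 ⊗ₜ b)) = 0 := fun a ha b => by
    rw [← shear_antipode_comul]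
    generalize comul (R := F) b = z
    induction z using TensorProduct.induction_on with
    | zero => simp
    | add x y hx hy => simp only [map_add, mul_add, hx, hy, add_zero]
    | tmul x y =>
      rw [LinearMap.rTensor_tmul, shear_tmul, mul_left_comm, hΛ, ← Bialgebra.comul_mul, hint, ha,
        zero_smul, mul_zero]
  have hmem : ∀ a ∈ R, comul (R := F) a ∈ LinearMap.range (R.subtype.lTensor B) := fun a ha => by
    refine (TensorProduct.mem_range_lTensor_subtype_iff R _).2 fun φ b => ?_
    have : ∀ z : B ⊗[F] B, Algebra.trace F B (TensorProduct.lid F B (φ.rTensor B z) * b) =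
        φ (Λ (z * (1 ⊗ₜ b))) := fun z => by
      induction z using TensorProduct.induction_on with
      | zero => simp
      | add x y hx hy => simp only [map_add, add_mul, hx, hy]
      | tmul x y => simp [Λ, mul_comm]
    rw [this, h1 a ha, map_zero]
  have hcounit : ∀ r ∈ R, counit (R := F) r = 0 := fun r hr => by
    obtain ⟨y, hy⟩ := hmem r hr
    have h2 := mul_antipode_rTensor_comul_apply (R := F) r
    rw [← hy] at h2
    have h3 : ∀ y : B ⊗[F] R, LinearMap.mul' F B ((antipode F).rTensor B
        (R.subtype.lTensor B y)) ∈ R := fun y => by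
      induction y using TensorProduct.induction_on with
      | zero => simp
      | add x y hx hy => simp only [map_add]; exact R.add_mem hx hy
      | tmul x r =>
        intro b
        have := r.2 (antipode F x * b)
        simp only [LinearMap.lTensor_tmul, LinearMap.rTensor_tmul, LinearMap.mul'_apply,
          Submodule.subtype_apply]
        rwa [mul_right_comm, mul_comm]
    have h4 := h3 y
    rw [h2] at h4
    have h5 := h4 1
    rw [mul_one, Algebra.trace_algebraMap] at h5
    have : Nontrivial B := ⟨⟨algebraMap F B 1, 0, fun h => by
      have := congrArg (counit (R := F)) h
      simp at this⟩⟩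
    exact (smul_eq_zero.1 h5).resolve_left Module.finrank_pos.ne'
  obtain ⟨y, hy⟩ := hmem a ha
  have h6 : (counit (R := F)).lTensor B (comul (R := F) a) = 0 := by
    rw [← hy, ← LinearMap.comp_apply, ← LinearMap.lTensor_comp,
      show counit ∘ₗ R.subtype = 0 from LinearMap.ext fun r => hcounit r r.2]
    simp
  rw [Coalgebra.lTensor_counit_comul] at h6
  simpa using congrArg (TensorProduct.rid F B) h6

theorem eq_zero_of_isNilpotent [CharZero F] {a : B} (ha : IsNilpotent a) : a = 0 :=
  eq_zero_of_forall_trace_mul (F := F) fun _ =>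
    (Algebra.isNilpotent_trace_of_isNilpotent ((Commute.all _ _).isNilpotent_mul_right ha)).eq_zero

/-- Every prime quotient of `B` is a finite field extension of `F`, hence `F` itself, so every prime
is the kernel of a point; an element in all primes is nilpotent, hence zero. -/
theorem eq_zero_of_forall_algHom [CharZero F] [IsAlgClosed F] {a : B}
    (ha : ∀ g : B →ₐ[F] F, g a = 0) : a = 0 := by
  refine eq_zero_of_isNilpotent (F := F) ?_
  rw [nilpotent_iff_mem_prime]
  intro P hP
  have : IsArtinianRing B := IsArtinianRing.of_finite F B
  have : P.IsMaximal := Ideal.IsPrime.isMaximal' hP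
  let : Field (B ⧸ P) := Ideal.Quotient.field P
  have hbij : Function.Bijective (algebraMap F (B ⧸ P)) :=
    IsAlgClosed.algebraMap_bijective_of_isIntegral
  let e := AlgEquiv.ofBijective (Algebra.ofId F (B ⧸ P)) hbij
  have := ha (e.symm.toAlgHom.comp (Ideal.Quotient.mkₐ F P))
  have h2 : e.symm (Ideal.Quotient.mk P a) = 0 := this
  exact Ideal.Quotient.eq_zero_iff_mem.1 ((map_eq_zero_iff _ e.symm.injective).1 h2)

theorem span_range_algHom [CharZero F] [IsAlgClosed F] :
    Submodule.span F (Set.range (AlgHom.toLinearMap : (B →ₐ[F] F) → B →ₗ[F] F)) = ⊤ := by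
  have h : Submodule.dualCoannihilator (Submodule.span F
      (Set.range (AlgHom.toLinearMap : (B →ₐ[F] F) → Module.Dual F B))) = ⊥ := by
    refine eq_bot_iff.2 fun a ha => ?_
    refine eq_zero_of_forall_algHom (F := F) fun g => ?_
    exact (Submodule.mem_dualCoannihilator _).1 ha _ (Submodule.subset_span ⟨g, rfl⟩)
  have := Subspace.dualCoannihilator_dualAnnihilator_eq (W := Submodule.span F
      (Set.range (AlgHom.toLinearMap : (B →ₐ[F] F) → Module.Dual F B)))
  rw [h, Submodule.dualAnnihilator_bot] at this
  exact this.symm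

end Trace

section Points

variable {K A : Type*} [Field K] [CharZero K] [CommRing A] [HopfAlgebra K A] [Module.Finite K A]
  (F : Type*) [Field F] [Algebra K F] [IsAlgClosed F]

/-- The geometric points of a finite group scheme in characteristic zero span the space of
functionals on the coordinate ring. -/
theorem mem_span_range_algHom (ψ : A →ₗ[K] F) :
    ψ ∈ Submodule.span F (Set.range (AlgHom.toLinearMap : (A →ₐ[K] F) → A →ₗ[K] F)) := by
  have : CharZero F := charZero_of_injective_algebraMap (algebraMap K F).injective
  let r : (F ⊗[K] A →ₗ[F] F) →ₗ[F] A →ₗ[K] F :=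
    { toFun := fun φ => φ.restrictScalars K ∘ₗ TensorProduct.mk K F A 1
      map_add' := fun _ _ => rfl
      map_smul' := fun _ _ => rfl }
  have h1 : r (LinearMap.liftBaseChange F ψ) = ψ := by
    ext a
    exact (LinearMap.liftBaseChange_tmul F ψ 1 a).trans (one_smul _ _)
  rw [← h1]
  have h2 : LinearMap.liftBaseChange F ψ ∈ Submodule.span F
      (Set.range (AlgHom.toLinearMap : (F ⊗[K] A →ₐ[F] F) → F ⊗[K] A →ₗ[F] F)) := by
    rw [span_range_algHom]; trivial
  have h3 := Submodule.mem_map_of_mem (f := r) h2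
  rw [Submodule.map_span] at h3
  refine Submodule.span_mono ?_ h3
  rintro _ ⟨_, ⟨g, rfl⟩, rfl⟩
  exact ⟨(g.restrictScalars K).comp Algebra.TensorProduct.includeRight, rfl⟩

end Points

end HopfAlgebra

/-! ### Counting edges and walks in the McKay graph. -/

section Combinatorics

variable {I : Type*} [Fintype I]

/-- The terms `a i j * (d j / d i + d i / d j - 2)` are nonnegative. The eigenvector equation makes
their sum `4|I| - 2∑a`, which is at most 0 by `hsum`, so each of them vanishes. -/
theorem eq_of_sum_adjacency_ge (a : I → I → ℕ) (hsymm : ∀ i j, a i j = a j i) (d : I → ℕ)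
    (hd : ∀ i, 0 < d i) (had : ∀ i, ∑ j, a i j * d j = 2 * d i)
    (hsum : 2 * Fintype.card I ≤ ∑ i, ∑ j, a i j) (i j : I) (hij : a i j ≠ 0) : d i = d j := by
  have hd' : ∀ i, (0 : ℝ) < d i := fun i => by exact_mod_cast hd i
  have e1 : ∑ i, ∑ j, (a i j : ℝ) * (d j / d i) = 2 * Fintype.card I := by
    have : ∀ i, ∑ j, (a i j : ℝ) * (d j / d i) = 2 := fun i => by
      have h : (∑ j, (a i j : ℝ) * d j) = 2 * d i := by exact_mod_cast had i
      simp_rw [← mul_div_assoc]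
      rw [← Finset.sum_div, h]
      field_simp [(hd' i).ne']
    simp [this, mul_comm]
  have e2 : ∑ i, ∑ j, (a i j : ℝ) * (d i / d j) = 2 * Fintype.card I := by
    rw [Finset.sum_comm, ← e1]
    simp_rw [fun i j => hsymm j i]
  have e3 : ((2 * Fintype.card I : ℕ) : ℝ) ≤ ((∑ i, ∑ j, a i j : ℕ) : ℝ) := by
    exact_mod_cast hsum
  push_cast at e3
  have hnn : ∀ i j, 0 ≤ (a i j : ℝ) * (d j / d i) + a i j * (d i / d j) - 2 * a i j := by
    intro i j
    have : (a i j : ℝ) * (d j / d i) + a i j * (d i / d j) - 2 * a i j =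
        a i j * ((d i - d j) ^ 2 / (d i * d j)) := by
      have := (hd' i).ne'; have := (hd' j).ne'
      field_simp; ring
    rw [this]
    have := hd' i; have := hd' j
    positivity
  have hz : ∑ i, ∑ j, ((a i j : ℝ) * (d j / d i) + a i j * (d i / d j) - 2 * a i j) = 0 := by
    refine le_antisymm ?_ (Finset.sum_nonneg fun i _ => Finset.sum_nonneg fun j _ => hnn i j)
    simp only [Finset.sum_sub_distrib, Finset.sum_add_distrib, ← Finset.mul_sum]
    rw [e1, e2]; linarith
  have hz1 := (Finset.sum_eq_zero_iff_of_nonneg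
    (fun i _ => Finset.sum_nonneg fun j _ => hnn i j)).1 hz i (Finset.mem_univ _)
  have hz2 := (Finset.sum_eq_zero_iff_of_nonneg (fun j _ => hnn i j)).1 hz1 j (Finset.mem_univ _)
  have hA : (a i j : ℝ) ≠ 0 := by exact_mod_cast hij
  have h1 := (hd' i).ne'
  have h2 := (hd' j).ne'
  field_simp at hz2
  rw [mul_zero] at hz2
  have h3 : ((d i : ℝ) - d j) ^ 2 = 0 := by
    linear_combination (mul_eq_zero.1 hz2).resolve_left hA
  have h4 : (d i : ℝ) = d j := sub_eq_zero.1 (pow_eq_zero_iff two_ne_zero |>.1 h3)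
  exact_mod_cast h4

/-- In a connected graph with a symmetric adjacency matrix `a` such that a positive function `d`
with `d i₀ = 1` is an eigenvector for the eigenvalue `2`, either `d` is constant or
each vertex is reached from `i₀` by exactly one walk of some length. -/
theorem const_or_exists_unique_walk (a : I → I → ℕ) (hsymm : ∀ i j, a i j = a j i) (d : I → ℕ)
    (hd : ∀ i, 0 < d i) (had : ∀ i, ∑ j, a i j * d j = 2 * d i) (c : ℕ → I → ℕ) (i₀ : I)
    (h0 : c 0 i₀ = 1) (h0' : ∀ i, i ≠ i₀ → c 0 i = 0)
    (hc : ∀ n j, c (n + 1) j = ∑ i, c n i * a i j) (hconn : ∀ i, ∃ n, c n i ≠ 0)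
    (hd0 : d i₀ = 1) : (∀ i, d i = 1) ∨ ∀ i, ∃ n, c n i = 1 := by
  classical
  -- `c n i` counts walks of length `n` from `i₀` to `i`, so `l` is the distance from `i₀`.
  let l : I → ℕ := fun i => Nat.find (hconn i)
  have hl : ∀ i, c (l i) i ≠ 0 := fun i => Nat.find_spec (hconn i)
  have hlmin : ∀ i n, c n i ≠ 0 → l i ≤ n := fun i n h => Nat.find_min' (hconn i) h
  have hstep : ∀ n i j, c n i ≠ 0 → a i j ≠ 0 → c (n + 1) j ≠ 0 := fun n i j h1 h2 => by
    rw [hc]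
    intro h
    have := (Finset.sum_eq_zero_iff.1 h) i (Finset.mem_univ _)
    exact mul_ne_zero h1 h2 this
  have hl0 : ∀ i, l i = 0 → i = i₀ := fun i h => by
    by_contra hne
    exact hl i (by rw [h]; exact h0' i hne)
  -- The number of edges into `j` from the preceding level.
  let p : I → ℕ := fun j => ∑ i with l i + 1 = l j, a i j
  have hcp : ∀ j, j ≠ i₀ → c (l j) j = ∑ i with l i + 1 = l j, c (l i) i * a i j := fun j hj => by
    obtain ⟨n, hn⟩ := Nat.exists_eq_succ_of_ne_zero (fun h => hj (hl0 j h))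
    rw [hn, Nat.succ_eq_add_one, hc]
    symm
    rw [Finset.sum_filter]
    refine Finset.sum_congr rfl fun i _ => ?_
    split_ifs with h
    · rw [show l i = n by omega]
    · by_contra hne
      have h1 : c n i ≠ 0 := fun h => hne (by simp [h])
      have h2 : a i j ≠ 0 := fun h => hne (by simp [h])
      have h3 := hlmin i n h1
      have h4 := hlmin j _ (hstep _ i j (hl i) h2)
      omega
  have hp : ∀ j, j ≠ i₀ → 1 ≤ p j := fun j hj => by
    by_contra h
    have h : p j = 0 := by omega
    apply hl j
    rw [hcp j hj]
    refine Finset.sum_eq_zero fun i hi => ?_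
    rw [(Finset.sum_eq_zero_iff.1 h) i hi, mul_zero]
  -- If each `p j` is 1, there is only one shortest walk to each vertex. Otherwise the graph has too
  -- many edges to be a tree, and the edge count applies.
  by_cases hall : ∀ j, j ≠ i₀ → p j = 1
  · right
    have : ∀ n j, l j = n → c n j = 1 := by
      intro n
      induction n with
      | zero => intro j hj; rw [hl0 j hj, h0]
      | succ n ih =>
        intro j hj
        have hne : j ≠ i₀ := fun h => by
          have := hlmin i₀ 0 (by rw [h0]; exact one_ne_zero)
          rw [h] at hj; omega
        rw [← hj, hcp j hne]
        refine Eq.trans ?_ (hall j hne)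
        refine Finset.sum_congr rfl fun i hi => ?_
        have hi : l i = n := by
          have := (Finset.mem_filter.1 hi).2
          omega
        rw [hi, ih i hi, one_mul]
    exact fun i => ⟨l i, this _ i rfl⟩
  · left
    push Not at hall
    obtain ⟨j₁, hj₁, hpj₁⟩ := hall
    -- All `|I| - 1` vertices other than `i₀` contribute at least 1, and `j₁` contributes at least
    -- 2.
    have hcard : Fintype.card I ≤ ∑ j, p j := by
      have hne : j₁ ∈ (Finset.univ.erase i₀ : Finset I) := by simp [hj₁]
      have h1 : ∑ j ∈ Finset.univ.erase i₀, p j ≤ ∑ j, p j :=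
        Finset.sum_le_sum_of_subset (Finset.erase_subset _ _)
      have h2 : ∑ j ∈ (Finset.univ.erase i₀ : Finset I), 1 < ∑ j ∈ Finset.univ.erase i₀, p j :=
        Finset.sum_lt_sum (fun j hj => hp j (Finset.ne_of_mem_erase hj))
          ⟨j₁, hne, lt_of_le_of_ne (hp j₁ hj₁) (Ne.symm hpj₁)⟩
      rw [Finset.sum_const, smul_eq_mul, mul_one, Finset.card_erase_of_mem (Finset.mem_univ _),
        Finset.card_univ] at h2
      omega
    have hsum : 2 * Fintype.card I ≤ ∑ i, ∑ j, a i j := by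
      have e1 : ∑ j, p j = ∑ j, ∑ i, if l i + 1 = l j then a i j else 0 :=
        Finset.sum_congr rfl fun j _ => Finset.sum_filter _ _
      have e2 : ∑ j, p j = ∑ j, ∑ i, if l j + 1 = l i then a i j else 0 := by
        rw [e1, Finset.sum_comm]
        refine Finset.sum_congr rfl fun i _ => Finset.sum_congr rfl fun j _ => ?_
        rw [hsymm]
      -- An edge between consecutive levels is counted in both directions by `∑ a`, and only once by
      -- `∑ p`.
      have e3 : ∑ j, p j + ∑ j, p j ≤ ∑ j, ∑ i, a i j := by
        nth_rw 1 [e1]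
        rw [e2, ← Finset.sum_add_distrib]
        refine Finset.sum_le_sum fun j _ => ?_
        rw [← Finset.sum_add_distrib]
        refine Finset.sum_le_sum fun i _ => ?_
        split_ifs <;> omega
      rw [Finset.sum_comm]
      omega
    have hedge := eq_of_sum_adjacency_ge a hsymm d hd had hsum
    have : ∀ n i, c n i ≠ 0 → d i = 1 := by
      intro n
      induction n with
      | zero =>
        intro i hi
        by_cases h : i = i₀
        · rw [h, hd0]
        · exact absurd (h0' i h) hi
      | succ n ih =>
        intro j hj
        rw [hc] at hj
        obtain ⟨i, -, hi⟩ := Finset.exists_ne_zero_of_sum_ne_zero hj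
        rw [← hedge i j (right_ne_zero_of_mul hi)]
        exact ih i (left_ne_zero_of_mul hi)
    exact fun i => this _ i (hl i)

end Combinatorics

/-! ### Maschke decompositions of representations of a finite group. -/

namespace Representation

section Subrepresentations

variable {F G V : Type*} [Field F] [Group G] [AddCommGroup V] [Module F V]
  {σ : Representation F G V}

/-- The image in `V` of a subrepresentation of a subrepresentation. -/
def subrepMap (T : Subrepresentation σ) (U : Subrepresentation T.toRepresentation) :
    Subrepresentation σ where
  toSubmodule := U.toSubmodule.map T.toSubmodule.subtype
  apply_mem_toSubmodule g v := by
    rintro ⟨u, hu, rfl⟩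
    exact ⟨T.toRepresentation g u, U.apply_mem_toSubmodule g hu, rfl⟩

theorem subrep_ne_bot_iff (T : Subrepresentation σ) : T ≠ ⊥ ↔ T.toSubmodule ≠ ⊥ :=
  not_congr ⟨fun h => by rw [h]; rfl, fun h => Subrepresentation.toSubmodule_injective h⟩

theorem exists_irreducible_le [FiniteDimensional F V] (T : Subrepresentation σ) (hT : T ≠ ⊥) :
    ∃ S : Subrepresentation σ, S ≤ T ∧ S.toRepresentation.IsIrreducible := by
  classical
  let P : ℕ → Prop := fun n => ∃ S : Subrepresentation σ, S ≤ T ∧ S ≠ ⊥ ∧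
    Module.finrank F S.toSubmodule = n
  have hP : ∃ n, P n := ⟨_, T, le_rfl, hT, rfl⟩
  obtain ⟨S, hST, hS, hn⟩ := Nat.find_spec hP
  refine ⟨S, hST, ?_⟩
  have hnt : Nontrivial S.toSubmodule :=
    Submodule.nontrivial_iff_ne_bot.2 ((subrep_ne_bot_iff S).1 hS)
  refine { exists_pair_ne := ⟨⊥, ⊤, fun h => ?_⟩, eq_bot_or_eq_top := fun U => ?_ }
  · have := congrArg Subrepresentation.toSubmodule h
    exact bot_ne_top (α := Submodule F S.toSubmodule) this
  · by_contra! hU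
    have hne : subrepMap S U ≠ ⊥ := by
      rw [subrep_ne_bot_iff]
      intro h
      have h' : U.toSubmodule.map S.toSubmodule.subtype = ⊥ := h
      exact (subrep_ne_bot_iff U).1 hU.1
        (Submodule.map_injective_of_injective (Submodule.injective_subtype _)
          (h'.trans (Submodule.map_bot _).symm))
    have hle : subrepMap S U ≤ S := by
      rintro _ ⟨u, -, rfl⟩
      exact u.2
    have h1 := Nat.find_min' hP ⟨subrepMap S U, hle.trans hST, hne, rfl⟩
    rw [← hn] at h1
    have h2 := Submodule.finrank_map_subtype_eq S.toSubmodule U.toSubmodule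
    have h3 : U.toSubmodule < ⊤ :=
      lt_top_iff_ne_top.2 fun h => hU.2 (Subrepresentation.toSubmodule_injective h)
    have h4 := Submodule.finrank_lt h3.ne
    exact absurd (h1.trans_eq h2) (not_le.2 h4)

theorem isCompl_toSubmodule {S T : Subrepresentation σ} (h : IsCompl S T) :
    IsCompl S.toSubmodule T.toSubmodule :=
  ⟨disjoint_iff.2 (congrArg Subrepresentation.toSubmodule (disjoint_iff.1 h.disjoint)),
    codisjoint_iff.2 (congrArg Subrepresentation.toSubmodule (codisjoint_iff.1 h.codisjoint))⟩

theorem toSubmodule_ne_bot_of_irreducible (S : Subrepresentation σ)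
    [h : S.toRepresentation.IsIrreducible] : S.toSubmodule ≠ ⊥ := by
  intro hb
  obtain ⟨U, U', hne⟩ := h.exists_pair_ne
  apply hne
  apply Subrepresentation.toSubmodule_injective
  have := (Submodule.subsingleton_iff_eq_bot (p := S.toSubmodule)).2 hb
  exact Subsingleton.elim _ _

/-- A nonzero complement of `Z` would contain an irreducible subrepresentation meeting `Z`
trivially. It allows linear identities to be checked on irreducible subrepresentations only. -/
theorem eq_top_of_irreducible_le [Finite G] [CharZero F] [FiniteDimensional F V]
    (Z : Subrepresentation σ)
    (hZ : ∀ S : Subrepresentation σ, S.toRepresentation.IsIrreducible → S ≤ Z) : Z = ⊤ := by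
  have : NeZero (Nat.card G : F) := ⟨by simpa using Nat.card_pos.ne'⟩
  obtain ⟨T, hT⟩ := exists_isCompl Z
  by_cases hb : T = ⊥
  · rw [hb] at hT
    exact eq_top_of_isCompl_bot hT
  · obtain ⟨S, hST, hS⟩ := exists_irreducible_le T hb
    have h : S ≤ ⊥ := hT.disjoint (hZ S hS) hST
    exact absurd (eq_bot_iff.2 h)
      ((subrep_ne_bot_iff S).2 (toSubmodule_ne_bot_of_irreducible S))

theorem exists_proj [Finite G] [CharZero F] (S : Subrepresentation σ) :
    ∃ p : IntertwiningMap σ S.toRepresentation, ∀ s : S.toSubmodule, p s = s := by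
  have : NeZero (Nat.card G : F) := ⟨by simpa using Nat.card_pos.ne'⟩
  obtain ⟨T, hT⟩ := exists_isCompl S
  have h := isCompl_toSubmodule hT
  refine ⟨⟨Submodule.projectionOnto _ _ h, fun g => ?_⟩, fun s =>
    Submodule.projectionOnto_apply_left h s⟩
  ext v
  obtain ⟨s, hs, t, ht, rfl⟩ := Submodule.mem_sup.1
    (h.sup_eq_top ▸ Submodule.mem_top : v ∈ S.toSubmodule ⊔ T.toSubmodule)
  have e1 := Submodule.projectionOnto_apply_left h ⟨s, hs⟩
  have e2 := Submodule.projectionOnto_apply_left h ⟨σ g s, S.apply_mem_toSubmodule g hs⟩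
  have e3 := Submodule.projectionOnto_apply_of_mem_right h ht
  have e4 := Submodule.projectionOnto_apply_of_mem_right h (T.apply_mem_toSubmodule g ht)
  simp only [LinearMap.comp_apply, map_add] at *
  rw [e1, e2, e3, e4, map_zero]
  rfl

theorem char_eq_add_of_isCompl [FiniteDimensional F V] {S T : Subrepresentation σ}
    (h : IsCompl S T) :
    σ.character = S.toRepresentation.character + T.toRepresentation.character := by
  ext g
  have h := isCompl_toSubmodule h
  let e := Submodule.prodEquivOfIsCompl _ _ h
  have h1 : e.symm.conj (σ g) =
      LinearMap.prodMap (S.toRepresentation g) (T.toRepresentation g) := by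
    apply LinearMap.ext
    intro x
    apply e.injective
    rw [LinearEquiv.conj_apply_apply, LinearEquiv.symm_symm, LinearEquiv.apply_symm_apply]
    simp only [e, Submodule.coe_prodEquivOfIsCompl', map_add, LinearMap.prodMap_apply]
    rfl
  have h2 := LinearMap.trace_conj' (σ g) e.symm
  rw [h1, LinearMap.trace_prodMap'] at h2
  exact h2.symm

end Subrepresentations

end Representation

/-! ### Irreducible characters and their orthogonality. -/

namespace Representation

section CharacterTheory

variable (F G : Type*) [Field F] [Group G] [Fintype G]

/-- The scalar product of functions on a finite group used in character theory. -/
def charInner (f h : G → F) : F := (Nat.card G : F)⁻¹ * ∑ g, f g * h g⁻¹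

variable {F G}

theorem charInner_comm (f h : G → F) : charInner F G f h = charInner F G h f := by
  unfold charInner
  rw [← Equiv.sum_comp (Equiv.inv G)]
  simp [mul_comm]

theorem charInner_sum_left {ι : Type*} (s : Finset ι) (c : ι → F) (f : ι → G → F) (h : G → F) :
    charInner F G (∑ i ∈ s, c i • f i) h = ∑ i ∈ s, c i * charInner F G (f i) h := by
  simp only [charInner, Finset.sum_apply, Pi.smul_apply, smul_eq_mul, Finset.sum_mul,
    Finset.mul_sum]
  rw [Finset.sum_comm]
  exact Finset.sum_congr rfl fun i _ => Finset.sum_congr rfl fun g _ => by ring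

theorem charInner_eq_finrank [CharZero F] {V W : Type*} [AddCommGroup V] [Module F V]
    [FiniteDimensional F V] [AddCommGroup W] [Module F W] [FiniteDimensional F W]
    (σ : Representation F G V) (τ : Representation F G W) :
    charInner F G τ.character σ.character = Module.finrank F (IntertwiningMap σ τ) := by
  let : Invertible (Nat.card G : F) := invertibleOfNonzero (by simp)
  exact card_inv_mul_sum_char_mul_char_eq_finrank σ τ

variable (F G) in
/-- The set of irreducible characters of a finite group. -/
def irrChar : Set (G → F) :=
  {χ | ∃ (d : ℕ) (σ : Representation F G (Fin d → F)), σ.IsIrreducible ∧ σ.character = χ}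

omit [Fintype G] in
theorem isIrreducible_of_equiv {V W : Type*} [AddCommGroup V] [Module F V]
    [AddCommGroup W] [Module F W] {σ : Representation F G V} {τ : Representation F G W}
    (e : Equiv σ τ) [h : σ.IsIrreducible] : τ.IsIrreducible := by
  let l : V ≃ₗ[F] W := e.toLinearEquiv
  have hl : ∀ g v, l (σ g v) = τ g (l v) :=
    IntertwiningMap.isIntertwining σ τ e.toIntertwiningMap
  let o : Subrepresentation σ ≃o Subrepresentation τ :=
    { toFun := fun S => ⟨S.toSubmodule.map (l : V →ₗ[F] W), by
        rintro g _ ⟨v, hv, rfl⟩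
        exact ⟨σ g v, S.apply_mem_toSubmodule g hv, hl g v⟩⟩
      invFun := fun S => ⟨S.toSubmodule.comap (l : V →ₗ[F] W), by
        intro g v hv
        rw [Submodule.mem_comap, LinearEquiv.coe_coe, hl]
        exact S.apply_mem_toSubmodule g hv⟩
      left_inv := fun S => Subrepresentation.toSubmodule_injective
        (Submodule.comap_map_eq_of_injective l.injective _)
      right_inv := fun S => Subrepresentation.toSubmodule_injective
        (Submodule.map_comap_eq_of_surjective l.surjective _)
      map_rel_iff' := fun {S T} =>
        Submodule.map_le_map_iff_of_injective l.injective _ _ }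
  exact o.isSimpleOrder_iff.1 h

omit [Fintype G] in
theorem character_mem_irrChar {V : Type*} [AddCommGroup V] [Module F V] [FiniteDimensional F V]
    (σ : Representation F G V) [σ.IsIrreducible] : σ.character ∈ irrChar F G := by
  let e := (Module.finBasis F V).equivFun
  let τ : Representation F G (Fin (Module.finrank F V) → F) :=
    (e.conjAlgEquiv F).toAlgHom.toMonoidHom.comp σ
  let E : Equiv σ τ := Equiv.mk e fun g => by
    ext v
    simp [τ, LinearEquiv.conjAlgEquiv_apply]
  exact ⟨_, τ, isIrreducible_of_equiv E, (char_iso E).symm⟩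

/-- Nonisomorphic irreducibles cannot share a character: the scalar product would be 0 by
orthogonality, but 1 as the dimension of the endomorphisms. -/
theorem charInner_irrChar [CharZero F] [IsAlgClosed F] [DecidableEq (G → F)] {χ χ' : G → F}
    (h : χ ∈ irrChar F G) (h' : χ' ∈ irrChar F G) :
    charInner F G χ χ' = if χ = χ' then 1 else 0 := by
  classical
  obtain ⟨d, σ, hσ, rfl⟩ := h
  obtain ⟨d', τ, hτ, rfl⟩ := h'
  let : Invertible (Nat.card G : F) := invertibleOfNonzero (by simp)
  have h1 := char_orthonormal σ τ
  by_cases he : Nonempty (Equiv τ σ)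
  · rw [if_pos he] at h1
    rw [if_pos (char_iso he.some).symm]
    exact h1
  · rw [if_neg he] at h1
    rw [if_neg]
    · exact h1
    · intro hch
      have h2 := charInner_eq_finrank σ σ
      rw [IsIrreducible.finrank_intertwiningMap_self σ] at h2
      nth_rw 2 [hch] at h2
      have h1 : charInner F G σ.character τ.character = 0 := h1
      rw [h1] at h2
      simp at h2

/-- Orthonormal functions are linearly independent, and `G → F` is finite-dimensional. -/
theorem irrChar_finite [CharZero F] [IsAlgClosed F] : (irrChar F G).Finite := by
  classical
  refine LinearIndependent.setFinite (R := F) (linearIndependent_iff'.2 fun s c hc i hi => ?_)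
  have h1 := charInner_sum_left s c (fun x : irrChar F G => (x : G → F)) i
  rw [hc] at h1
  have h2 : ∀ j ∈ s, c j * charInner F G (j : G → F) (i : G → F) = if j = i then c i else 0 := by
    intro j _
    rw [charInner_irrChar j.2 i.2]
    by_cases h : j = i
    · simp [h]
    · rw [if_neg h, if_neg fun h' => h (Subtype.ext h'), mul_zero]
  rw [Finset.sum_congr rfl h2, Finset.sum_ite_eq', if_pos hi] at h1
  rw [← h1]
  simp [charInner]

theorem exists_character_eq_sum [CharZero F] [IsAlgClosed F] [Fintype (irrChar F G)] :
    ∀ (m : ℕ) {V : Type*} [AddCommGroup V] [Module F V] [FiniteDimensional F V]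
    (σ : Representation F G V), Module.finrank F V = m →
    ∃ n : irrChar F G → ℕ, σ.character = ∑ χ, (n χ : F) • (χ : G → F) := by
  classical
  intro m
  induction m using Nat.strong_induction_on with
  | _ m ih =>
  intro V _ _ _ σ hm
  have : NeZero (Nat.card G : F) := ⟨by simp⟩
  by_cases htop : (⊤ : Subrepresentation σ) = ⊥
  · refine ⟨0, ?_⟩
    have h : (⊤ : Submodule F V) = ⊥ := congrArg Subrepresentation.toSubmodule htop
    have : Subsingleton V := (Submodule.subsingleton_iff F).1 (subsingleton_of_bot_eq_top h.symm)
    ext g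
    simp [character, Subsingleton.elim (σ g) 0]
  · obtain ⟨S, -, hS⟩ := exists_irreducible_le _ htop
    obtain ⟨T, hT⟩ := exists_isCompl S
    have h1 := Submodule.finrank_add_eq_of_isCompl (isCompl_toSubmodule hT)
    have h2 : 0 < Module.finrank F S.toSubmodule :=
      have := Submodule.nontrivial_iff_ne_bot.2 (toSubmodule_ne_bot_of_irreducible S)
      Module.finrank_pos
    obtain ⟨n, hn⟩ := ih _ (by omega) T.toRepresentation rfl
    refine ⟨n + Pi.single ⟨_, character_mem_irrChar S.toRepresentation⟩ 1, ?_⟩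
    rw [char_eq_add_of_isCompl hT, hn]
    simp only [Pi.add_apply, Nat.cast_add, add_smul, Finset.sum_add_distrib]
    rw [add_comm]
    congr 1
    rw [Finset.sum_eq_single ⟨_, character_mem_irrChar S.toRepresentation⟩]
    · simp
    · intro b _ hb
      simp [Pi.single_eq_of_ne hb]
    · simp

end CharacterTheory

end Representation

/-! ### Kronecker powers, and unipotent matrices of finite order. -/

namespace Matrix

variable {R : Type*} [CommRing R]

/-- The `n`-th Kronecker power of a square matrix. -/
def kroneckerPow {m : Type*} (M : Matrix m m R) (n : ℕ) : Matrix (Fin n → m) (Fin n → m) R :=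
  of fun s t => ∏ k, M (s k) (t k)

theorem kroneckerPow_mul {m : Type*} [Fintype m] (M M' : Matrix m m R) (n : ℕ) :
    kroneckerPow (M * M') n = kroneckerPow M n * kroneckerPow M' n := by
  ext s t
  simp only [kroneckerPow, of_apply, mul_apply, ← Finset.prod_mul_distrib]
  rw [Finset.prod_univ_sum]
  simp

theorem kroneckerPow_one {m : Type*} [DecidableEq m] (n : ℕ) :
    kroneckerPow (1 : Matrix m m R) n = 1 := by
  ext s t
  simp only [kroneckerPow, of_apply, one_apply]
  by_cases h : s = t
  · simp [h]
  · rw [if_neg h]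
    obtain ⟨k, hk⟩ := Function.ne_iff.1 h
    exact Finset.prod_eq_zero (Finset.mem_univ k) (if_neg hk)

theorem trace_kroneckerPow {m : Type*} [Fintype m] (M : Matrix m m R) (n : ℕ) :
    (kroneckerPow M n).trace = M.trace ^ n := by
  have := Finset.prod_univ_sum (fun _ : Fin n => (Finset.univ : Finset m)) fun _ j => M j j
  simp only [Finset.prod_const, Finset.card_univ, Fintype.card_fin, Fintype.piFinset_univ] at this
  simp only [trace, diag_apply]
  rw [this]
  rfl

/-- The characteristic polynomial is `(X - 1)²`, so `M ^ n = 1 + n(M - 1)`, and finite order forces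
`M = 1` in characteristic 0. -/
theorem eq_one_of_trace_eq_two [CharZero R] [IsDomain R] {M : Matrix (Fin 2) (Fin 2) R}
    (hdet : M.det = 1) (htr : M.trace = 2) {n : ℕ} (hn : n ≠ 0) (hM : M ^ n = 1) : M = 1 := by
  have h1 := aeval_self_charpoly M
  rw [charpoly_fin_two, hdet, htr] at h1
  have h2 : (M - 1) * (M - 1) = 0 := by
    rw [← h1]
    simp only [map_add, map_sub, map_mul, map_pow, Polynomial.aeval_X, Polynomial.aeval_C]
    rw [map_ofNat, map_one]
    noncomm_ring
  have h3 : ∀ k : ℕ, M ^ k = 1 + (k : R) • (M - 1) := fun k => by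
    induction k with
    | zero => simp
    | succ k ih =>
      have : M ^ (k + 1) = M ^ k * (1 + (M - 1)) := by rw [pow_succ]; congr 1; abel
      rw [this, ih, add_mul, mul_add, mul_add, smul_mul_assoc, smul_mul_assoc, h2]
      push_cast
      rw [add_smul]
      simp
      abel
  have h4 := h3 n
  rw [hM, eq_comm, add_eq_left] at h4
  have h5 := (smul_eq_zero.1 h4).resolve_left (by exact_mod_cast hn)
  exact sub_eq_zero.1 h5

end Matrix

/-! ### The McKay graph of a finite subgroup of `SL(2, F)`. -/

namespace Representation

open Matrix

variable {F G : Type*} [Field F] [Group G]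

/-- The `n`-th tensor power of the two-dimensional representation given by `N : G → SL(2, F)`. -/
def kroneckerRep (N : G →* SpecialLinearGroup (Fin 2) F) (n : ℕ) :
    Representation F G ((Fin n → Fin 2) → F) where
  toFun g := toLinAlgEquiv' (kroneckerPow (N g).1 n)
  map_one' := by simp [kroneckerPow_one]
  map_mul' g h := by simp [kroneckerPow_mul]

theorem character_kroneckerRep (N : G →* SpecialLinearGroup (Fin 2) F) (n : ℕ) (g : G) :
    (kroneckerRep N n).character g = (N g).1.trace ^ n := by
  rw [← trace_kroneckerPow]
  exact trace_toLin'_eq _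

theorem trace_inv_eq (M : SpecialLinearGroup (Fin 2) F) : (M⁻¹).1.trace = M.1.trace := by
  simp [adjugate_fin_two, trace_fin_two, add_comm]

variable [Fintype G] [CharZero F] [IsAlgClosed F]

/-- For a finite subgroup of `SL(2, F)`, either all irreducible characters are linear or each of
them occurs with multiplicity one in some tensor power of the natural representation. -/
theorem irrChar_dichotomy (N : G →* SpecialLinearGroup (Fin 2) F) (hN : Function.Injective N) :
    (∀ χ ∈ irrChar F G, χ 1 = 1) ∨
      ∀ χ ∈ irrChar F G, ∃ n, charInner F G (kroneckerRep N n).character χ = 1 := by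
  classical
  let t : G → F := (kroneckerRep N 1).character
  have ht : ∀ g, t g = (N g).1.trace := fun g => by simp [t, character_kroneckerRep]
  have htinv : ∀ g, t g⁻¹ = t g := fun g => by rw [ht, ht, map_inv, trace_inv_eq]
  have ht1 : t 1 = 2 := by simp [ht]
  have hpow : ∀ n, (kroneckerRep N n).character = t ^ n := fun n => by
    ext g; rw [character_kroneckerRep, Pi.pow_apply, ht]
  let _ : Fintype (irrChar F G) := irrChar_finite.fintype
  have hdeg : ∀ χ : irrChar F G, ∃ d : ℕ, 0 < d ∧ (χ : G → F) 1 = d := by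
    rintro ⟨_, d, σ, hσ, rfl⟩
    refine ⟨d, ?_, by simp⟩
    by_contra hd
    have hd : d = 0 := by omega
    subst hd
    obtain ⟨U, U', hne⟩ := hσ.exists_pair_ne
    exact hne (Subrepresentation.toSubmodule_injective (Subsingleton.elim _ _))
  choose d hd0 hd using hdeg
  -- The matrix `a` is the adjacency matrix of the McKay graph.
  have hmul : ∀ χ : irrChar F G, ∃ a : irrChar F G → ℕ,
      t * (χ : G → F) = ∑ χ', (a χ' : F) • (χ' : G → F) := by
    rintro ⟨_, e, σ, hσ, rfl⟩
    obtain ⟨a, ha⟩ := exists_character_eq_sum _ (tprod (kroneckerRep N 1) σ) rfl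
    exact ⟨a, by rw [← ha, char_tensor]⟩
  choose a ha using hmul
  have hcoef : ∀ (b : irrChar F G → ℕ) (χ : irrChar F G),
      charInner F G (∑ χ', (b χ' : F) • (χ' : G → F)) χ = b χ := fun b χ => by
    rw [charInner_sum_left, Finset.sum_eq_single χ]
    · rw [charInner_irrChar χ.2 χ.2, if_pos rfl, mul_one]
    · intro χ' _ hne
      rw [charInner_irrChar χ'.2 χ.2, if_neg fun h => hne (Subtype.ext h), mul_zero]
    · simp
  have hcp : ∀ n, ∃ c : irrChar F G → ℕ, t ^ n = ∑ χ', (c χ' : F) • (χ' : G → F) := fun n => by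
    rw [← hpow]
    exact exists_character_eq_sum _ _ rfl
  choose c hc using hcp
  have hcI : ∀ n (χ : irrChar F G), charInner F G (t ^ n) χ = c n χ := fun n χ => by
    rw [hc, hcoef]
  have haI : ∀ χ χ' : irrChar F G, charInner F G (t * (χ : G → F)) χ' = a χ χ' := fun χ χ' => by
    rw [ha, hcoef]
  -- Symmetry of `a` comes from `t(g⁻¹) = t(g)`, which holds for traces on `SL(2)`.
  have hasymm : ∀ χ χ', a χ χ' = a χ' χ := fun χ χ' => by
    have : (a χ χ' : F) = a χ' χ := by
      rw [← haI, ← haI, charInner_comm]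
      unfold charInner
      congr 1
      refine Finset.sum_congr rfl fun g _ => ?_
      simp only [Pi.mul_apply, htinv]
      ring
    exact_mod_cast this
  have had : ∀ χ, ∑ χ', a χ χ' * d χ' = 2 * d χ := fun χ => by
    have h := congrFun (ha χ) 1
    simp only [Pi.mul_apply, Finset.sum_apply, Pi.smul_apply, hd, smul_eq_mul, ht1] at h
    exact_mod_cast h.symm
  have htriv : (1 : G → F) ∈ irrChar F G := by
    have h1 : (trivial F G F).IsIrreducible := by
      refine { exists_pair_ne := ⟨⊥, ⊤, fun h => ?_⟩, eq_bot_or_eq_top := fun U => ?_ }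
      · exact bot_ne_top (α := Submodule F F) (congrArg Subrepresentation.toSubmodule h)
      · exact (eq_bot_or_eq_top U.toSubmodule).imp
          (fun h => Subrepresentation.toSubmodule_injective h)
          (fun h => Subrepresentation.toSubmodule_injective h)
    have := character_mem_irrChar (trivial F G F)
    convert this
    ext g
    simp [character]
  let χ₀ : irrChar F G := ⟨1, htriv⟩
  have h0 : ∀ χ, (c 0 χ : F) = if χ = χ₀ then 1 else 0 := fun χ => by
    rw [← hcI, pow_zero, charInner_irrChar htriv χ.2]
    simp only [eq_comm (a := (1 : G → F)), ← Subtype.val_inj (b := χ₀), χ₀]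
  have hcs : ∀ n χ, c (n + 1) χ = ∑ χ', c n χ' * a χ' χ := fun n χ => by
    have : (c (n + 1) χ : F) = ∑ χ', (c n χ' : F) * a χ' χ := by
      rw [← hcI, pow_succ, hc n, Finset.sum_mul]
      simp_rw [smul_mul_assoc, mul_comm _ t]
      rw [charInner_sum_left]
      simp_rw [haI]
    exact_mod_cast this
  have hfaith : ∀ g, t g = 2 → g = 1 := fun g hg => by
    apply hN
    rw [map_one]
    apply Subtype.ext
    refine eq_one_of_trace_eq_two (N g).2 ((ht g).symm.trans hg) (Fintype.card_ne_zero (α := G)) ?_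
    have : N g ^ Fintype.card G = 1 := by rw [← map_pow, pow_card_eq_one, map_one]
    exact congrArg Subtype.val this
  -- Burnside's argument: `t` takes the value 2 only at the identity. If `χ` were orthogonal to all
  -- powers of `t`, it would be orthogonal to `p(t)` for every polynomial `p`.
  have hconn : ∀ χ, ∃ n, c n χ ≠ 0 := fun χ => by
    by_contra! hall
    have h1 : ∀ n, ∑ g, t g ^ n * (χ : G → F) g⁻¹ = 0 := fun n => by
      have := hcI n χ
      rw [hall, Nat.cast_zero] at this
      exact (mul_eq_zero.1 this).resolve_left (by simp)
    have h2 : ∀ p : Polynomial F, ∑ g, p.eval (t g) * (χ : G → F) g⁻¹ = 0 := fun p => by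
      simp_rw [Polynomial.eval_eq_sum_range, Finset.sum_mul]
      rw [Finset.sum_comm]
      refine Finset.sum_eq_zero fun i _ => ?_
      simp_rw [mul_assoc]
      rw [← Finset.mul_sum, h1, mul_zero]
    -- `p` vanishes at every value of `t` except 2, so only the term of `g = 1` survives, and `p(2)
    -- χ(1) ≠ 0`.
    let p : Polynomial F := ∏ v ∈ (Finset.univ.image t).erase 2, (Polynomial.X - Polynomial.C v)
    have h3 := h2 p
    rw [Finset.sum_eq_single 1] at h3
    · rw [inv_one, hd, ht1] at h3
      rcases mul_eq_zero.1 h3 with h | h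
      · rw [Polynomial.eval_prod, Finset.prod_eq_zero_iff] at h
        obtain ⟨v, hv, hv0⟩ := h
        simp only [Polynomial.eval_sub, Polynomial.eval_X, Polynomial.eval_C] at hv0
        exact (Finset.mem_erase.1 hv).1 (sub_eq_zero.1 hv0).symm
      · exact (hd0 χ).ne' (by exact_mod_cast h)
    · intro g _ hg
      have : p.eval (t g) = 0 := by
        rw [Polynomial.eval_prod]
        refine Finset.prod_eq_zero (i := t g) ?_ (by simp)
        exact Finset.mem_erase.2 ⟨fun h => hg (hfaith g h), Finset.mem_image_of_mem _ (by simp)⟩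
      rw [this, zero_mul]
    · simp
  rcases const_or_exists_unique_walk a hasymm d hd0 had c χ₀
    (by have := h0 χ₀; rw [if_pos rfl] at this; exact_mod_cast this)
    (fun χ hχ => by have := h0 χ; rw [if_neg hχ] at this; exact_mod_cast this) hcs hconn
    (by have : (1 : F) = d χ₀ := hd χ₀; exact_mod_cast this.symm) with h | h
  · left
    intro χ hχ
    exact (hd ⟨χ, hχ⟩).trans (by rw [h, Nat.cast_one])
  · right
    intro χ hχ
    obtain ⟨n, hn⟩ := h ⟨χ, hχ⟩
    exact ⟨n, by rw [hpow, hcI n ⟨χ, hχ⟩, hn, Nat.cast_one]⟩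

end Representation

/-! ### Commutativity from each side of the dichotomy. -/

namespace Representation

variable {F G V : Type*} [Field F] [Group G] [Fintype G] [CharZero F]
  [AddCommGroup V] [Module F V] [FiniteDimensional F V]

/-- If all irreducible characters are linear, then the group acts through commuting operators. -/
theorem commute_of_irrChar_one (h : ∀ χ ∈ irrChar F G, χ 1 = 1) (π : Representation F G V)
    (g k : G) (v : V) : π g (π k v) = π k (π g v) := by
  let Z : Subrepresentation π :=
    { toSubmodule :=
        { carrier := {v | ∀ g h, π (g * h) v = π (h * g) v}
          add_mem' := fun hx hy g h => by rw [map_add, map_add, hx g h, hy g h]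
          zero_mem' := fun g h => by rw [map_zero, map_zero]
          smul_mem' := fun c x hx g h => by rw [map_smul, map_smul, hx g h] }
      apply_mem_toSubmodule := fun k v hv g h => by
        have e : ∀ x y : G, π (x * y) (π k v) = π k (π ((k⁻¹ * x * k) * (k⁻¹ * y * k)) v) :=
          fun x y => by
            rw [← Module.End.mul_apply, ← Module.End.mul_apply, ← map_mul, ← map_mul]
            congr 2
            group
        rw [e, e, hv] }
  have hZ : Z = ⊤ := eq_top_of_irreducible_le Z fun S hS => by
    have h1 : Module.finrank F S.toSubmodule = 1 := by
      have := h _ (character_mem_irrChar S.toRepresentation)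
      rw [char_one] at this
      exact_mod_cast this
    have h2 : ∀ g, ∃ c : F, ∀ s ∈ S.toSubmodule, π g s = c • s := fun g => by
      obtain ⟨s₀, hs₀, hgen⟩ := finrank_eq_one_iff'.1 h1
      obtain ⟨c, hc⟩ := hgen (S.toRepresentation g s₀)
      refine ⟨c, fun s hs => ?_⟩
      obtain ⟨b, hb⟩ := hgen ⟨s, hs⟩
      have hb' : b • (s₀ : V) = s := congrArg Subtype.val hb
      have hc' : c • (s₀ : V) = π g s₀ := congrArg Subtype.val hc
      rw [← hb', map_smul, ← hc', smul_comm]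
    intro v hv g k
    obtain ⟨c, hc⟩ := h2 g
    obtain ⟨c', hc'⟩ := h2 k
    rw [map_mul, map_mul, Module.End.mul_apply, Module.End.mul_apply, hc' v hv, hc v hv, map_smul,
      map_smul, hc v hv, hc' v hv, smul_comm]
  have : v ∈ Z := by rw [hZ]; exact Submodule.mem_top
  rw [← Module.End.mul_apply, ← Module.End.mul_apply, ← map_mul, ← map_mul]
  exact this g k

/-- If a representation embeds into every member of a family to which it has a nonzero map, and
each irreducible representation occurs with multiplicity one in some member of the family, then
its endomorphism algebra is commutative. -/
theorem intertwiningMap_comm {ι : Type*} {X : ι → Type*} [∀ n, AddCommGroup (X n)]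
    [∀ n, Module F (X n)] [∀ n, FiniteDimensional F (X n)] (τ : ∀ n, Representation F G (X n))
    (h : ∀ χ ∈ irrChar F G, ∃ n, charInner F G (τ n).character χ = 1) (π : Representation F G V)
    (hπ : ∀ n (f : IntertwiningMap π (τ n)), f ≠ 0 →
      ∃ j : IntertwiningMap π (τ n), Function.Injective j)
    (T T' : IntertwiningMap π π) (v : V) : T (T' v) = T' (T v) := by
  have hscalar : ∀ (S : Subrepresentation π), S.toRepresentation.IsIrreducible →
      ∀ T : IntertwiningMap π π, ∃ c : F, ∀ s ∈ S.toSubmodule, T s = c • s := by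
    intro S hS T
    obtain ⟨n, hn⟩ := h _ (character_mem_irrChar S.toRepresentation)
    rw [charInner_eq_finrank] at hn
    have hn : Module.finrank F (IntertwiningMap S.toRepresentation (τ n)) = 1 := by
      exact_mod_cast hn
    obtain ⟨f₀, hf₀, -⟩ := finrank_eq_one_iff'.1 hn
    obtain ⟨p, hp⟩ := exists_proj S
    -- Extend the map `f₀ : S → X n` by a projection onto `S`; the resulting nonzero map on `V`
    -- supplies the embedding `j`.
    have hne : f₀.comp p ≠ 0 := fun h0 => hf₀ <| IntertwiningMap.ext <| LinearMap.ext fun s => by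
      have := DFunLike.congr_fun h0 (s : V)
      rw [IntertwiningMap.comp_apply, hp] at this
      exact this
    obtain ⟨j, hj⟩ := hπ n _ hne
    let ι : IntertwiningMap S.toRepresentation π := ⟨S.toSubmodule.subtype, fun g => rfl⟩
    have hjι : j.comp ι ≠ 0 := fun h0 => by
      have := Submodule.nontrivial_iff_ne_bot.2 (toSubmodule_ne_bot_of_irreducible S)
      obtain ⟨s, hs⟩ := exists_ne (0 : S.toSubmodule)
      have h1 : j (s : V) = 0 := DFunLike.congr_fun h0 s
      exact hs (Subtype.ext (hj (h1.trans (map_zero j).symm)))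
    -- `j ∘ ι` and `j ∘ T ∘ ι` lie in a one-dimensional space and the first is nonzero; cancelling
    -- `j` shows that `T` is a scalar on `S`.
    obtain ⟨c, hc⟩ := exists_smul_eq_of_finrank_eq_one hn hjι (j.comp (T.comp ι))
    refine ⟨c, fun s hs => hj ?_⟩
    have h1 : c • j s = j (T s) := DFunLike.congr_fun hc ⟨s, hs⟩
    rw [← h1, map_smul]
  let Z : Subrepresentation π :=
    { toSubmodule := LinearMap.eqLocus (T.comp T').toLinearMap (T'.comp T).toLinearMap
      apply_mem_toSubmodule := fun g v hv => by
        have hv : (T.comp T') v = (T'.comp T) v := hv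
        change (T.comp T') (π g v) = (T'.comp T) (π g v)
        rw [IntertwiningMap.isIntertwining, IntertwiningMap.isIntertwining, hv] }
  have hZ : Z = ⊤ := eq_top_of_irreducible_le Z fun S hS s hs => by
    obtain ⟨c, hc⟩ := hscalar S hS T
    obtain ⟨c', hc'⟩ := hscalar S hS T'
    change T (T' s) = T' (T s)
    rw [hc s hs, hc' s hs, map_smul, map_smul, hc s hs, hc' s hs, smul_comm]
  have hv : v ∈ Z := by rw [hZ]; exact Submodule.mem_top
  exact hv

end Representation

/-! ### The finite group of geometric points and its map to `SL(2)`. -/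

section Points

variable (K A F : Type*) [Field K] [CommRing A] [HopfAlgebra K A] [Field F] [Algebra K F]

/-- The group of `F`-points of `Spec A`, with the opposite of the convolution product, so that it
acts from the left on left comodules. -/
def GeomPoints : Type _ := (WithConv (A →ₐ[K] F))ᵐᵒᵖ

instance : Monoid (GeomPoints K A F) := inferInstanceAs (Monoid (WithConv (A →ₐ[K] F))ᵐᵒᵖ)

instance : Group (GeomPoints K A F) where
  inv g := MulOpposite.op (WithConv.toConv
    ((MulOpposite.unop g).ofConv.comp (HopfAlgebra.antipodeAlgHom K A)))
  inv_mul_cancel g := by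
    apply MulOpposite.unop_injective
    apply WithConv.ofConv_injective
    ext a
    have h : ∀ z : A ⊗[K] A, LinearMap.mul' K F (TensorProduct.map
        (MulOpposite.unop g).ofConv.toLinearMap ((MulOpposite.unop g).ofConv.comp
          (HopfAlgebra.antipodeAlgHom K A)).toLinearMap z) =
        (MulOpposite.unop g).ofConv (LinearMap.mul' K A
          ((HopfAlgebra.antipode K).lTensor A z)) := fun z => by
      induction z using TensorProduct.induction_on with
      | zero => simp
      | add x y hx hy => simp only [map_add, hx, hy]
      | tmul x y => simp
    refine (h (Coalgebra.comul a)).trans ?_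
    rw [HopfAlgebra.mul_antipode_lTensor_comul_apply, AlgHom.commutes]
    rfl

variable {K A F}

/-- The linear form `A → F` given by a point. -/
def GeomPoints.toLinearMap (g : GeomPoints K A F) : A →ₗ[K] F :=
  (MulOpposite.unop g).ofConv.toLinearMap

instance [Module.Finite K A] : Finite (GeomPoints K A F) :=
  Finite.of_injective (fun g : GeomPoints K A F => (MulOpposite.unop g).ofConv) fun _ _ h =>
    MulOpposite.unop_injective (WithConv.ofConv_injective h)

theorem GeomPoints.toLinearMap_mul (g h : GeomPoints K A F) :
    (g * h).toLinearMap =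
      (WithConv.toConv h.toLinearMap * WithConv.toConv g.toLinearMap).ofConv :=
  congrArg WithConv.ofConv (AlgHom.toLinearMap_convMul (MulOpposite.unop h) (MulOpposite.unop g))

theorem GeomPoints.toLinearMap_one :
    (1 : GeomPoints K A F).toLinearMap = Algebra.linearMap K F ∘ₗ Coalgebra.counit := rfl

theorem GeomPoints.mem_span [CharZero K] [Module.Finite K A] [IsAlgClosed F] (ψ : A →ₗ[K] F) :
    ψ ∈ Submodule.span F (Set.range (GeomPoints.toLinearMap : GeomPoints K A F → A →ₗ[K] F)) := by
  refine Submodule.span_mono ?_ (HopfAlgebra.mem_span_range_algHom F ψ)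
  rintro _ ⟨g, rfl⟩
  exact ⟨MulOpposite.op (WithConv.toConv g), rfl⟩

theorem mem_span_range_linearMap_comp [Module.Finite K A] (ψ : A →ₗ[K] F) :
    ψ ∈ Submodule.span F (Set.range fun φ : A →ₗ[K] K => Algebra.linearMap K F ∘ₗ φ) := by
  let b := Module.finBasis K A
  have : ψ = ∑ i, ψ (b i) • (Algebra.linearMap K F ∘ₗ b.coord i) := by
    refine b.ext fun j => ?_
    simp [LinearMap.sum_apply, Finsupp.single_apply, Finset.sum_ite_eq]
  rw [this]
  exact Submodule.sum_mem _ fun i _ => Submodule.smul_mem _ _ (Submodule.subset_span ⟨_, rfl⟩)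

variable {W : Type*} [AddCommGroup W] [Module K W]

/-- The representation of the group of points on `F ⊗ W` given by a comodule `W`. -/
def Coaction.geomRep (ρ : Coaction K A W) : Representation F (GeomPoints K A F) (F ⊗[K] W) where
  toFun g := coactOpL F ρ.map g.toLinearMap
  map_one' := by rw [GeomPoints.toLinearMap_one, ρ.coactOpL_counit]; rfl
  map_mul' g h := by rw [GeomPoints.toLinearMap_mul, ρ.coactOpL_convMul]; rfl

theorem Coaction.geomRep_apply (ρ : Coaction K A W) (g : GeomPoints K A F) (v : F ⊗[K] W) :
    ρ.geomRep g v = coactOpL F ρ.map g.toLinearMap v := rfl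

variable (F) in
/-- The two-dimensional representation of the group of points given by a homomorphism to
`SL(2)`. -/
def geomPointsToSL (i : SL2Ring K →ₐc[K] A) :
    GeomPoints K A F →* Matrix.SpecialLinearGroup (Fin 2) F where
  -- The transpose compensates for the opposite group law on `GeomPoints`.
  toFun g := (Matrix.SpecialLinearGroup.map
    (((MulOpposite.unop g).ofConv : A →+* F).comp (i : SL2Ring K →+* A))
      (SL2Ring.generic K)).transpose
  map_one' := by
    ext k l
    have h := CoalgHomClass.counit_comp_apply i ((SL2Ring.generic K).1 l k)
    have h2 : Coalgebra.counit (R := K) ((SL2Ring.generic K).1 l k) =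
      (1 : Matrix (Fin 2) (Fin 2) K) l k := SL2Ring.counitHom_generic K l k
    have h3 : (MulOpposite.unop (1 : GeomPoints K A F)).ofConv (i ((SL2Ring.generic K).1 l k)) =
        algebraMap K F (Coalgebra.counit (i ((SL2Ring.generic K).1 l k))) := rfl
    rw [h, h2] at h3
    refine h3.trans ?_
    by_cases hkl : k = l <;> simp [Matrix.one_apply, hkl, eq_comm]
  map_mul' g h := by
    ext k l
    have h1 : Coalgebra.comul (R := K) ((SL2Ring.generic K).1 l k) =
      ∑ m, (SL2Ring.generic K).1 l m ⊗ₜ[K] (SL2Ring.generic K).1 m k :=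
      SL2Ring.comulHom_generic K l k
    have h2 := CoalgHomClass.map_comp_comul_apply i ((SL2Ring.generic K).1 l k)
    rw [h1] at h2
    have h3 : (MulOpposite.unop (g * h)).ofConv (i ((SL2Ring.generic K).1 l k)) =
      (WithConv.toConv h.toLinearMap * WithConv.toConv g.toLinearMap)
        (i ((SL2Ring.generic K).1 l k)) := rfl
    rw [LinearMap.convMul_apply, ← h2] at h3
    refine h3.trans ?_
    simp only [map_sum, TensorProduct.map_tmul, LinearMap.mul'_apply]
    rw [Matrix.SpecialLinearGroup.coe_mul, Matrix.mul_apply]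
    exact Finset.sum_congr rfl fun m _ => mul_comm _ _

theorem geomPointsToSL_injective (i : SL2Ring K →ₐc[K] A) (hi : Function.Surjective i) :
    Function.Injective (geomPointsToSL F i) := by
  intro g h hgh
  apply MulOpposite.unop_injective
  apply WithConv.ofConv_injective
  have : (MulOpposite.unop g).ofConv.comp (i : SL2Ring K →ₐ[K] A) =
      (MulOpposite.unop h).ofConv.comp (i : SL2Ring K →ₐ[K] A) :=
    SL2Ring.hom_ext fun k l => congrArg (fun M => M.1 l k) hgh
  ext a
  obtain ⟨x, rfl⟩ := hi a
  exact DFunLike.congr_fun this x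

end Points

/-! ### Commutativity of the endomorphisms of an irreducible comodule. -/

namespace Coaction

variable {K A W : Type*} [Field K] [CommRing A] [HopfAlgebra K A] [AddCommGroup W] [Module K W]

theorem exists_coactOp_comp (ρ : Coaction K A W) (φ φ' : A →ₗ[K] K) :
    ∃ φ'', ∀ w, coactOp ρ.map φ (coactOp ρ.map φ' w) = coactOp ρ.map φ'' w := by
  refine ⟨(WithConv.toConv φ' * WithConv.toConv φ).ofConv, fun w => ?_⟩
  have h := LinearMap.congr_fun (ρ.coactOpL_convMul (L := K) (WithConv.toConv φ')
    (WithConv.toConv φ)) (1 ⊗ₜ w)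
  have hid : ∀ (φ : A →ₗ[K] K) w, coactOpL K ρ.map φ (1 ⊗ₜ w) = 1 ⊗ₜ coactOp ρ.map φ w :=
    fun φ w => by
      rw [← coactOpL_linearMap_tmul (L := K)]
      congr 2
  rw [LinearMap.comp_apply, hid, hid, hid] at h
  have := congrArg (TensorProduct.lid K W) h
  simpa using this.symm

/-- The vectors obtained from `w` by operators form a subrepresentation, since operators are closed
under composition; it contains `w` because the counit acts as the identity. -/
theorem exists_coactOp_eq (ρ : Coaction K A W) (hρ : ρ.IsIrreducible) {w : W} (hw : w ≠ 0)
    (w' : W) : ∃ φ, coactOp ρ.map φ w = w' := by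
  let f : (A →ₗ[K] K) →ₗ[K] W :=
    { toFun := fun φ => coactOp ρ.map φ w
      map_add' := fun φ φ' => by simp [coactOp_apply, LinearMap.rTensor_add]
      map_smul' := fun c φ => by simp [coactOp_apply, LinearMap.rTensor_smul] }
  have hst : ρ.IsStable (LinearMap.range f) := by
    rw [isStable_iff]
    rintro φ _ ⟨φ', rfl⟩
    obtain ⟨φ'', h⟩ := ρ.exists_coactOp_comp φ φ'
    exact ⟨φ'', (h w).symm⟩
  rcases hρ.2 _ hst with h | h
  · exfalso
    have : w ∈ LinearMap.range f := ⟨Coalgebra.counit, ρ.coactOp_counit w⟩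
    rw [h] at this
    exact hw this
  · have : w' ∈ LinearMap.range f := by rw [h]; trivial
    exact this

theorem finiteDimensional_of_isIrreducible [Module.Finite K A] (ρ : Coaction K A W)
    (hρ : ρ.IsIrreducible) : FiniteDimensional K W := by
  have := hρ.1
  obtain ⟨w, hw⟩ := exists_ne (0 : W)
  let f : (A →ₗ[K] K) →ₗ[K] W :=
    { toFun := fun φ => coactOp ρ.map φ w
      map_add' := fun φ φ' => by simp [coactOp_apply, LinearMap.rTensor_add]
      map_smul' := fun c φ => by simp [coactOp_apply, LinearMap.rTensor_smul] }
  exact Module.Finite.of_surjective f fun w' => ρ.exists_coactOp_eq hρ hw w'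

end Coaction

namespace Coaction

open Representation

variable {K A W : Type*} [Field K] [CommRing A] [HopfAlgebra K A] [AddCommGroup W] [Module K W]
variable {F : Type*} [Field F] [Algebra K F]

/-- At a given nonzero `w`, both `d` and `d'` agree with operators, which commute with each other
and with endomorphisms. -/
theorem comm_of_coactOp_comm (ρ : Coaction K A W) (hρ : ρ.IsIrreducible)
    (h : ∀ φ φ' w, coactOp ρ.map φ (coactOp ρ.map φ' w) = coactOp ρ.map φ' (coactOp ρ.map φ w))
    (d d' : W →ₗ[K] W) (hd : ∀ φ w, d (coactOp ρ.map φ w) = coactOp ρ.map φ (d w))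
    (hd' : ∀ φ w, d' (coactOp ρ.map φ w) = coactOp ρ.map φ (d' w)) (w : W) :
    d (d' w) = d' (d w) := by
  by_cases hw : w = 0
  · simp [hw]
  obtain ⟨φ, hφ⟩ := ρ.exists_coactOp_eq hρ hw (d w)
  obtain ⟨φ', hφ'⟩ := ρ.exists_coactOp_eq hρ hw (d' w)
  rw [← hφ', hd, ← hφ, hd', ← hφ', h]

/-- The matrix of values of `ψ` at the matrix coefficients of the `n`-th tensor power of the
natural representation. -/
def kroneckerCoeff (i : SL2Ring K →ₐc[K] A) (n : ℕ) (ψ : A →ₗ[K] F) :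
    Matrix (Fin n → Fin 2) (Fin n → Fin 2) F :=
  Matrix.of fun s t => ψ (∏ k, i ((SL2Ring.generic K).1 (t k) (s k)))

theorem kroneckerCoeff_geomPoints (i : SL2Ring K →ₐc[K] A) (n : ℕ) (g : GeomPoints K A F) :
    kroneckerCoeff i n g.toLinearMap = Matrix.kroneckerPow (geomPointsToSL F i g).1 n := by
  ext s t
  exact map_prod (MulOpposite.unop g).ofConv _ _

/-- Both sides are `F`-linear in `ψ`. Geometric points and `K`-rational functionals both span, so
equivariance can be transferred between the two. -/
theorem coactOpL_comm_of_span {ρ : W →ₗ[K] A ⊗[K] W} (i : SL2Ring K →ₐc[K] A) (n : ℕ)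
    (f : F ⊗[K] W →ₗ[F] (Fin n → Fin 2) → F) {S : Set (A →ₗ[K] F)}
    (hS : ∀ ψ ∈ S, ∀ v, f (coactOpL F ρ ψ v) = (kroneckerCoeff i n ψ).mulVec (f v))
    (ψ : A →ₗ[K] F) (hψ : ψ ∈ Submodule.span F S) (v : F ⊗[K] W) :
    f (coactOpL F ρ ψ v) = (kroneckerCoeff i n ψ).mulVec (f v) := by
  induction hψ using Submodule.span_induction generalizing v with
  | mem ψ h => exact hS ψ h v
  | zero =>
    have h1 : coactOpL F ρ (0 : A →ₗ[K] F) = 0 := by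
      simpa using coactOpL_smul ρ (0 : F) (0 : A →ₗ[K] F)
    have h2 : kroneckerCoeff i n (0 : A →ₗ[K] F) = 0 := rfl
    simp [h1, h2]
  | add ψ ψ' _ _ h h' =>
    have h2 : kroneckerCoeff i n (ψ + ψ') = kroneckerCoeff i n ψ + kroneckerCoeff i n ψ' := rfl
    rw [coactOpL_add, LinearMap.add_apply, map_add, h, h', h2, Matrix.add_mulVec]
  | smul c ψ _ h =>
    have h2 : kroneckerCoeff i n (c • ψ) = c • kroneckerCoeff i n ψ := rfl
    rw [coactOpL_smul, LinearMap.smul_apply, map_smul, h, h2, Matrix.smul_mulVec]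

variable [CharZero K] [Module.Finite K A] [IsAlgClosed F]

/-- If an irreducible `W` has a nonzero map to a tensor power of the natural representation over
the algebraic closure, then it embeds into it. -/
theorem exists_injective_intertwiningMap (ρ : Coaction K A W) (hρ : ρ.IsIrreducible)
    (i : SL2Ring K →ₐc[K] A) (n : ℕ)
    (f : IntertwiningMap (ρ.geomRep (F := F)) (kroneckerRep (geomPointsToSL F i) n)) (hf : f ≠ 0) :
    ∃ j : IntertwiningMap (ρ.geomRep (F := F)) (kroneckerRep (geomPointsToSL F i) n),
      Function.Injective j := by
  have hfψ : ∀ (ψ : A →ₗ[K] F) v, f.toLinearMap (coactOpL F ρ.map ψ v) =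
      (kroneckerCoeff i n ψ).mulVec (f.toLinearMap v) := fun ψ =>
    coactOpL_comm_of_span i n f.toLinearMap (by
      rintro _ ⟨g, rfl⟩ v
      rw [kroneckerCoeff_geomPoints]
      exact f.isIntertwining _ _ g v) ψ (GeomPoints.mem_span ψ)
  obtain ⟨w, s, hws⟩ : ∃ w s, f.toLinearMap (1 ⊗ₜ w) s ≠ 0 := by
    by_contra! h
    apply hf
    apply IntertwiningMap.ext
    apply TensorProduct.AlgebraTensorModule.curry_injective
    ext w s
    exact h w s
  -- A `K`-linear functional on `F` cuts a nonzero `K`-rational component `j₀` out of `f`. The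
  -- tensor power has matrix coefficients over `K`, so `j₀` is equivariant; its kernel is a
  -- subrepresentation of `W`, hence zero, and the base change of `j₀` is the embedding.
  obtain ⟨μ, hμ⟩ : ∃ μ : F →ₗ[K] K, μ (f.toLinearMap (1 ⊗ₜ w) s) ≠ 0 := by
    by_contra! h
    exact hws ((Module.forall_dual_apply_eq_zero_iff K _).1 h)
  let j₀ : W →ₗ[K] (Fin n → Fin 2) → K :=
    μ.compLeft _ ∘ₗ (f.toLinearMap.restrictScalars K ∘ₗ TensorProduct.mk K F W 1)
  have hj₀ : ∀ w s, j₀ w s = μ (f.toLinearMap (1 ⊗ₜ w) s) := fun _ _ => rfl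
  have hj₀φ : ∀ (φ : A →ₗ[K] K) w,
      j₀ (coactOp ρ.map φ w) = (kroneckerCoeff i n φ).mulVec (j₀ w) := fun φ w => by
    ext s
    rw [hj₀, ← coactOpL_linearMap_tmul, hfψ]
    simp only [Matrix.mulVec, dotProduct, map_sum, hj₀]
    refine Finset.sum_congr rfl fun t _ => ?_
    have : kroneckerCoeff i n (Algebra.linearMap K F ∘ₗ φ) s t =
      algebraMap K F (kroneckerCoeff i n φ s t) := rfl
    rw [this, ← Algebra.smul_def, map_smul, smul_eq_mul]
  have hker : LinearMap.ker j₀ = ⊥ := by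
    have hst : ρ.IsStable (LinearMap.ker j₀) := by
      rw [isStable_iff]
      intro φ u hu
      rw [LinearMap.mem_ker] at hu ⊢
      rw [hj₀φ, hu, Matrix.mulVec_zero]
    refine (hρ.2 _ hst).resolve_right fun h => hμ ?_
    have : w ∈ LinearMap.ker j₀ := by rw [h]; trivial
    rw [← hj₀, LinearMap.mem_ker.1 this]
    rfl
  let j : F ⊗[K] W →ₗ[F] (Fin n → Fin 2) → F :=
    (TensorProduct.piScalarRight K F F (Fin n → Fin 2)).toLinearMap ∘ₗ j₀.baseChange F
  have hj : ∀ l w s, j (l ⊗ₜ w) s = l * algebraMap K F (j₀ w s) := fun l w s => by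
    simp [j, Algebra.smul_def, mul_comm]
  have hjψ : ∀ (ψ : A →ₗ[K] F) v, j (coactOpL F ρ.map ψ v) =
      (kroneckerCoeff i n ψ).mulVec (j v) := fun ψ =>
    coactOpL_comm_of_span i n j (by
      rintro _ ⟨φ, rfl⟩ v
      induction v using TensorProduct.induction_on with
      | zero => simp
      | add x y hx hy => simp only [map_add, Matrix.mulVec_add, hx, hy]
      | tmul l w =>
        ext s
        rw [coactOpL_linearMap_tmul, hj, hj₀φ]
        simp only [Matrix.mulVec, dotProduct, map_sum, hj, Finset.mul_sum, map_mul]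
        refine Finset.sum_congr rfl fun t _ => ?_
        have : kroneckerCoeff i n (Algebra.linearMap K F ∘ₗ φ) s t =
          algebraMap K F (kroneckerCoeff i n φ s t) := rfl
        rw [this]
        ring) ψ (mem_span_range_linearMap_comp ψ)
  refine ⟨⟨j, fun g => LinearMap.ext fun v => ?_⟩, ?_⟩
  · refine (hjψ g.toLinearMap v).trans ?_
    rw [kroneckerCoeff_geomPoints]
    rfl
  · exact (TensorProduct.piScalarRight K F F (Fin n → Fin 2)).injective.comp
      (Module.Flat.lTensor_preserves_injective_linearMap j₀ (LinearMap.ker_eq_bot.1 hker))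

theorem coactOpL_comm_of_geomRep_comm (ρ : Coaction K A W) (T : F ⊗[K] W →ₗ[F] F ⊗[K] W)
    (hT : ∀ (g : GeomPoints K A F) v, T (ρ.geomRep g v) = ρ.geomRep g (T v)) (ψ : A →ₗ[K] F)
    (v : F ⊗[K] W) : T (coactOpL F ρ.map ψ v) = coactOpL F ρ.map ψ (T v) := by
  induction GeomPoints.mem_span ψ using Submodule.span_induction generalizing v with
  | mem ψ h =>
    obtain ⟨g, rfl⟩ := h
    exact hT g v
  | zero =>
    have h1 : coactOpL F ρ.map (0 : A →ₗ[K] F) = 0 := by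
      simpa using coactOpL_smul ρ.map (0 : F) (0 : A →ₗ[K] F)
    simp [h1]
  | add ψ ψ' _ _ h h' =>
    rw [coactOpL_add, LinearMap.add_apply, map_add, h, h', LinearMap.add_apply]
  | smul c ψ _ h => rw [coactOpL_smul, LinearMap.smul_apply, map_smul, h, LinearMap.smul_apply]

omit [CharZero K] [Module.Finite K A] [IsAlgClosed F] in
theorem baseChange_coactOpL (ρ : Coaction K A W) (d : W →ₗ[K] W)
    (hd : ρ.map ∘ₗ d = d.lTensor A ∘ₗ ρ.map) (ψ : A →ₗ[K] F) (v : F ⊗[K] W) :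
    d.baseChange F (coactOpL F ρ.map ψ v) = coactOpL F ρ.map ψ (d.baseChange F v) := by
  induction v using TensorProduct.induction_on with
  | zero => simp
  | add x y hx hy => simp only [map_add, hx, hy]
  | tmul l w =>
    have h := LinearMap.congr_fun hd w
    simp only [LinearMap.comp_apply] at h
    rw [LinearMap.baseChange_tmul, coactOpL_tmul, coactOpL_tmul, map_smul, h]
    congr 1
    generalize ρ.map w = z
    induction z using TensorProduct.induction_on with
    | zero => simp
    | add x y hx hy => simp only [map_add, hx, hy]
    | tmul a w => simp

variable (K) in
/-- The endomorphism algebra of an irreducible representation of a finite subgroup scheme of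
`SL(2)` is commutative. -/
theorem endomorphisms_comm (ρ : Coaction K A W) (hρ : ρ.IsIrreducible)
    (i : SL2Ring K →ₐc[K] A) (hi : Function.Surjective i)
    (d d' : W →ₗ[K] W) (hd : ∀ φ w, d (coactOp ρ.map φ w) = coactOp ρ.map φ (d w))
    (hd' : ∀ φ w, d' (coactOp ρ.map φ w) = coactOp ρ.map φ (d' w)) (w : W) :
    d (d' w) = d' (d w) := by
  have : CharZero (AlgebraicClosure K) :=
    charZero_of_injective_algebraMap (algebraMap K (AlgebraicClosure K)).injective
  have _ : Fintype (GeomPoints K A (AlgebraicClosure K)) := Fintype.ofFinite _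
  have := ρ.finiteDimensional_of_isIrreducible hρ
  rcases irrChar_dichotomy (geomPointsToSL (AlgebraicClosure K) i)
    (geomPointsToSL_injective i hi) with h | h
  · refine ρ.comm_of_coactOp_comm hρ (fun φ φ' w => ?_) d d' hd hd' w
    have hcomm := commute_of_irrChar_one h ρ.geomRep
    -- The spanning argument is used twice: points commute with points, hence with all operators,
    -- hence operators commute among themselves.
    have h1 := ρ.coactOpL_comm_of_geomRep_comm
      (coactOpL (AlgebraicClosure K) ρ.map (Algebra.linearMap K _ ∘ₗ φ))
      (fun g v => (ρ.coactOpL_comm_of_geomRep_comm (ρ.geomRep g)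
        (fun k v => hcomm g k v) _ v).symm)
      (Algebra.linearMap K _ ∘ₗ φ') (1 ⊗ₜ w)
    simp only [coactOpL_linearMap_tmul] at h1
    exact Module.FaithfullyFlat.tensorProduct_mk_injective (A := K) (B := AlgebraicClosure K) W h1
  · have key := intertwiningMap_comm (kroneckerRep (geomPointsToSL (AlgebraicClosure K) i)) h
      ρ.geomRep (fun n f hf => ρ.exists_injective_intertwiningMap hρ i n f hf)
      ⟨d.baseChange _, fun g => LinearMap.ext fun v =>
        ρ.baseChange_coactOpL d ((coact_comm_iff _ _ d).2 hd) g.toLinearMap v⟩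
      ⟨d'.baseChange _, fun g => LinearMap.ext fun v =>
        ρ.baseChange_coactOpL d' ((coact_comm_iff _ _ d').2 hd') g.toLinearMap v⟩ (1 ⊗ₜ w)
    simp only [IntertwiningMap.coe_mk, LinearMap.baseChange_tmul] at key
    exact Module.FaithfullyFlat.tensorProduct_mk_injective (A := K) (B := AlgebraicClosure K) W key

end Coaction

/-! ### Endomorphisms of `L ⊗ W` from those of `W`. -/

section Components

variable {K W L : Type*} [Field K] [AddCommGroup W] [Module K W] [Field L] [Algebra K L]

/-- The component `w ↦ (μ ⊗ 1)(T (1 ⊗ w))` of an `L`-linear endomorphism of `L ⊗ W`. -/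
def endComponent (T : L ⊗[K] W →ₗ[L] L ⊗[K] W) (μ : L →ₗ[K] K) : W →ₗ[K] W :=
  (TensorProduct.lid K W).toLinearMap ∘ₗ μ.rTensor W ∘ₗ T.restrictScalars K ∘ₗ
    TensorProduct.mk K L W 1

theorem endComponent_apply (T : L ⊗[K] W →ₗ[L] L ⊗[K] W) (μ : L →ₗ[K] K) (w : W) :
    endComponent T μ w = TensorProduct.lid K W (μ.rTensor W (T (1 ⊗ₜ w))) := rfl

/-- Allowing every larger `S'` lets one finite set serve for the images of a whole basis of `W`. -/
theorem exists_eq_sum_basis_tmul {ι : Type*} (b : Module.Basis ι K L) (z : L ⊗[K] W) :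
    ∃ S : Finset ι, ∀ S', S ⊆ S' →
      z = ∑ s ∈ S', b s ⊗ₜ TensorProduct.lid K W ((b.coord s).rTensor W z) := by
  classical
  induction z using TensorProduct.induction_on with
  | zero => exact ⟨∅, fun S' _ => by simp⟩
  | add x y hx hy =>
    obtain ⟨S, hS⟩ := hx
    obtain ⟨T, hT⟩ := hy
    refine ⟨S ∪ T, fun S' h => ?_⟩
    simp only [map_add, TensorProduct.tmul_add, Finset.sum_add_distrib]
    rw [← hS S' (Finset.union_subset_left h), ← hT S' (Finset.union_subset_right h)]
  | tmul l w =>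
    refine ⟨(b.repr l).support, fun S' h => ?_⟩
    conv_lhs => rw [← b.linearCombination_repr l, Finsupp.linearCombination_apply,
      Finsupp.sum_of_support_subset _ h _ (by simp), TensorProduct.sum_tmul]
    exact Finset.sum_congr rfl fun s _ => by simp [TensorProduct.smul_tmul]

/-- Expanding `T (1 ⊗ w)` in a `K`-basis of `L`, possibly infinite, needs only finitely many terms
for all `w`, as `W` is finite-dimensional. -/
theorem mem_span_range_endComponent [FiniteDimensional K W] (T : L ⊗[K] W →ₗ[L] L ⊗[K] W) :
    T ∈ Submodule.span L (Set.range fun μ => (endComponent T μ).baseChange L) := by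
  classical
  obtain ⟨b⟩ : Nonempty (Module.Basis _ K L) := ⟨Module.Basis.ofVectorSpace K L⟩
  obtain ⟨B⟩ : Nonempty (Module.Basis (Fin (Module.finrank K W)) K W) := ⟨Module.finBasis K W⟩
  choose S hS using fun k => exists_eq_sum_basis_tmul b (T (1 ⊗ₜ B k))
  have hT : T = ∑ s ∈ Finset.univ.biUnion S,
      b s • (endComponent T (b.coord s)).baseChange L := by
    refine (B.baseChange L).ext fun k => ?_
    rw [Module.Basis.baseChange_apply, LinearMap.sum_apply]
    refine (hS k _ (Finset.subset_biUnion_of_mem S (Finset.mem_univ k))).trans ?_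
    refine Finset.sum_congr rfl fun s _ => ?_
    rw [LinearMap.smul_apply, LinearMap.baseChange_tmul, TensorProduct.smul_tmul', smul_eq_mul,
      mul_one, endComponent_apply]
  have hmem : ∑ s ∈ Finset.univ.biUnion S, b s • (endComponent T (b.coord s)).baseChange L ∈
      Submodule.span L (Set.range fun μ => (endComponent T μ).baseChange L) :=
    Submodule.sum_mem _ fun s _ => Submodule.smul_mem _ _ (Submodule.subset_span ⟨_, rfl⟩)
  rwa [← hT] at hmem

variable {A : Type*} [AddCommGroup A] [Module K A]

theorem endComponent_coactOp (ρ : W →ₗ[K] A ⊗[K] W) (T : L ⊗[K] W →ₗ[L] L ⊗[K] W)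
    (hT : ∀ ψ v, T (coactOpL L ρ ψ v) = coactOpL L ρ ψ (T v)) (μ : L →ₗ[K] K) (φ : A →ₗ[K] K)
    (w : W) : endComponent T μ (coactOp ρ φ w) = coactOp ρ φ (endComponent T μ w) := by
  rw [endComponent_apply, endComponent_apply, ← coactOpL_linearMap_tmul, hT]
  generalize T (1 ⊗ₜ w) = z
  induction z using TensorProduct.induction_on with
  | zero => simp
  | add x y hx hy => simp only [map_add, hx, hy]
  | tmul l v => simp [coactOpL_linearMap_tmul]

/-- If the endomorphisms of `W` commute, then so do those of `L ⊗ W`. -/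
theorem baseChange_endomorphisms_comm [FiniteDimensional K W] (ρ : W →ₗ[K] A ⊗[K] W)
    (hD : ∀ d d' : W →ₗ[K] W, (∀ φ w, d (coactOp ρ φ w) = coactOp ρ φ (d w)) →
      (∀ φ w, d' (coactOp ρ φ w) = coactOp ρ φ (d' w)) → ∀ w, d (d' w) = d' (d w))
    (T T' : L ⊗[K] W →ₗ[L] L ⊗[K] W)
    (hT : ∀ ψ v, T (coactOpL L ρ ψ v) = coactOpL L ρ ψ (T v))
    (hT' : ∀ ψ v, T' (coactOpL L ρ ψ v) = coactOpL L ρ ψ (T' v)) : T ∘ₗ T' = T' ∘ₗ T := by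
  have h1 : ∀ μ μ', (endComponent T μ).baseChange L ∘ₗ (endComponent T' μ').baseChange L =
      (endComponent T' μ').baseChange L ∘ₗ (endComponent T μ).baseChange L := fun μ μ' => by
    rw [← LinearMap.baseChange_comp, ← LinearMap.baseChange_comp]
    congr 1
    ext w
    exact hD _ _ (endComponent_coactOp ρ T hT μ) (endComponent_coactOp ρ T' hT' μ') w
  have h2 : ∀ (Y : L ⊗[K] W →ₗ[L] L ⊗[K] W) (s : Set (L ⊗[K] W →ₗ[L] L ⊗[K] W)),
      (∀ X ∈ s, Y ∘ₗ X = X ∘ₗ Y) → ∀ X ∈ Submodule.span L s, Y ∘ₗ X = X ∘ₗ Y := by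
    intro Y s hs X hX
    induction hX using Submodule.span_induction with
    | mem X h => exact hs X h
    | zero => simp
    | add X X' _ _ h h' => rw [LinearMap.comp_add, LinearMap.add_comp, h, h']
    | smul c X _ h => rw [LinearMap.comp_smul, LinearMap.smul_comp, h]
  refine (h2 T' _ ?_ T (mem_span_range_endComponent T)).symm
  rintro _ ⟨μ, rfl⟩
  refine (h2 _ _ ?_ T' (mem_span_range_endComponent T')).symm
  rintro _ ⟨μ', rfl⟩
  exact h1 μ μ'

end Components

/-! ### Galois descent for subspaces. -/

section GaloisDescent

variable {K W L : Type*} [Field K] [AddCommGroup W] [Module K W] [Field L] [Algebra K L]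

variable (W) in
/-- The semilinear action of the Galois group on `L ⊗ W`. -/
def galTensor (γ : L ≃ₐ[K] L) : L ⊗[K] W →ₛₗ[(γ : L →+* L)] L ⊗[K] W where
  toFun := (γ.toLinearMap : L →ₗ[K] L).rTensor W
  map_add' := map_add _
  map_smul' l x := by
    induction x using TensorProduct.induction_on with
    | zero => simp
    | add x y hx hy => simp only [smul_add, map_add, hx, hy]
    | tmul b c => simp [TensorProduct.smul_tmul']

theorem galTensor_tmul (γ : L ≃ₐ[K] L) (l : L) (w : W) :
    galTensor W γ (l ⊗ₜ w) = γ l ⊗ₜ w := rfl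

theorem galTensor_mul (γ δ : L ≃ₐ[K] L) (v : L ⊗[K] W) :
    galTensor W (γ * δ) v = galTensor W γ (galTensor W δ v) := by
  induction v using TensorProduct.induction_on with
  | zero => simp
  | add x y hx hy => simp only [map_add, hx, hy]
  | tmul l w => rfl

theorem galTensor_one (v : L ⊗[K] W) : galTensor W (1 : L ≃ₐ[K] L) v = v := by
  induction v using TensorProduct.induction_on with
  | zero => simp
  | add x y hx hy => simp only [map_add, hx, hy]
  | tmul l w => rfl

theorem galTensor_coactOpL {A : Type*} [AddCommGroup A] [Module K A] (ρ : W →ₗ[K] A ⊗[K] W)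
    (γ : L ≃ₐ[K] L) (ψ : A →ₗ[K] L) (v : L ⊗[K] W) :
    galTensor W γ (coactOpL L ρ ψ v) =
      coactOpL L ρ (γ.toLinearMap ∘ₗ ψ) (galTensor W γ v) := by
  induction v using TensorProduct.induction_on with
  | zero => simp
  | add x y hx hy => simp only [map_add, hx, hy]
  | tmul l w =>
    rw [coactOpL_tmul, galTensor_tmul, coactOpL_tmul, LinearMap.map_smulₛₗ]
    congr 1
    generalize ρ w = z
    induction z using TensorProduct.induction_on with
    | zero => simp
    | add x y hx hy => simp only [map_add, hx, hy]
    | tmul l w => rfl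

/-- Galois descent: a nonzero Galois-stable subspace of `L ⊗ W` contains a nonzero rational
vector. -/
theorem exists_one_tmul_mem [IsGalois K L] [FiniteDimensional K W] (U : Submodule L (L ⊗[K] W))
    (hU : U ≠ ⊥) (hγ : ∀ γ : L ≃ₐ[K] L, ∀ v ∈ U, galTensor W γ v ∈ U) :
    ∃ w : W, w ≠ 0 ∧ (1 : L) ⊗ₜ[K] w ∈ U := by
  classical
  let b := Module.finBasis K W
  let B := b.baseChange L
  have hB : ∀ (γ : L ≃ₐ[K] L) v i, B.repr (galTensor W γ v) i = γ (B.repr v i) := fun γ v i => by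
    induction v using TensorProduct.induction_on with
    | zero => simp
    | add x y hx hy => simp only [map_add, Finsupp.add_apply, hx, hy]
    | tmul l w => simp [B, galTensor_tmul]
  -- Take a nonzero vector of `U` with the fewest nonzero coordinates and scale one coordinate to 1.
  -- Then `γu - u` lies in `U` with smaller support, so it is zero, and the coordinates of `u` are
  -- Galois-invariant.
  let P : ℕ → Prop := fun n => ∃ v ∈ U, v ≠ 0 ∧ (B.repr v).support.card = n
  have hP : ∃ n, P n := by
    obtain ⟨v, hv, hv0⟩ := (Submodule.ne_bot_iff U).1 hU
    exact ⟨_, v, hv, hv0, rfl⟩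
  obtain ⟨v, hv, hv0, hn⟩ := Nat.find_spec hP
  obtain ⟨i₀, hi₀⟩ : ∃ i, B.repr v i ≠ 0 := by
    by_contra! h
    exact hv0 (B.repr.map_eq_zero_iff.1 (Finsupp.ext h))
  let u := (B.repr v i₀)⁻¹ • v
  have hu : ∀ i, B.repr u i = (B.repr v i₀)⁻¹ * B.repr v i := fun i => by simp [u]
  have hfix : ∀ γ : L ≃ₐ[K] L, galTensor W γ u = u := fun γ => by
    by_contra hne
    have huU : u ∈ U := U.smul_mem _ hv
    have h1 := Nat.find_min' hP
      ⟨galTensor W γ u - u, U.sub_mem (hγ γ u huU) huU, sub_ne_zero.2 hne, rfl⟩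
    rw [← hn] at h1
    refine absurd h1 (not_le.2 (Finset.card_lt_card (Finset.ssubset_iff_of_subset ?_ |>.2
      ⟨i₀, Finsupp.mem_support_iff.2 hi₀, ?_⟩)))
    · intro i hi
      rw [Finsupp.mem_support_iff] at hi ⊢
      contrapose! hi
      rw [map_sub, Finsupp.sub_apply, hB, hu, hi]
      simp
    · rw [Finsupp.notMem_support_iff, map_sub, Finsupp.sub_apply, hB, hu, inv_mul_cancel₀ hi₀]
      simp
  have hrat : ∀ i, ∃ k : K, algebraMap K L k = B.repr u i := fun i =>
    (InfiniteGalois.mem_range_algebraMap_iff_fixed (k := K) (B.repr u i)).2 fun γ => by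
      rw [← hB, hfix]
  choose k hk using hrat
  have hw : (1 : L) ⊗ₜ[K] (∑ i, k i • b i) = u := by
    apply B.repr.injective
    ext i
    rw [Module.Basis.baseChange_repr_tmul, ← hk, b.repr_sum_self, Algebra.smul_def, mul_one]
  refine ⟨∑ i, k i • b i, fun h0 => ?_, by rw [hw]; exact U.smul_mem _ hv⟩
  rw [h0, TensorProduct.tmul_zero] at hw
  have := hu i₀
  rw [← hw, inv_mul_cancel₀ hi₀] at this
  simp at this

end GaloisDescent

/-! ### Semisimple modules with commutative endomorphism ring. -/

section SemisimpleModules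

variable {R M : Type*} [Ring R] [AddCommGroup M] [Module R M]

/-- If the endomorphism ring of a semisimple module is commutative, then isomorphic submodules
are equal. -/
theorem Submodule.le_of_linearEquiv_of_comm [IsSemisimpleModule R M]
    (hcomm : ∀ t t' : M →ₗ[R] M, t ∘ₗ t' = t' ∘ₗ t) {P Q : Submodule R M} (e : P ≃ₗ[R] Q) :
    Q ≤ P := by
  obtain ⟨P', hP'⟩ := ComplementedLattice.exists_isCompl P
  let q := P.projectionOnto P' hP'
  have hq : ∀ x : P, q x = x := P.projectionOnto_apply_left hP'
  intro x hx
  obtain ⟨p, hp⟩ := e.surjective ⟨x, hx⟩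
  -- With `t` the projection to `P` and `t'` that projection followed by `e`, evaluate at `p = e⁻¹
  -- x`: `t' (t p) = x`, while `t (t' p)` lies in `P`.
  have h := LinearMap.congr_fun (hcomm (P.subtype ∘ₗ q) (Q.subtype ∘ₗ e.toLinearMap ∘ₗ q)) p
  simp only [LinearMap.comp_apply, LinearEquiv.coe_coe, hq, Submodule.subtype_apply, hp] at h
  rw [← h]
  exact (q x).2

theorem Submodule.eq_of_linearEquiv_of_comm [IsSemisimpleModule R M]
    (hcomm : ∀ t t' : M →ₗ[R] M, t ∘ₗ t' = t' ∘ₗ t) {P Q : Submodule R M} (e : P ≃ₗ[R] Q) :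
    P = Q :=
  (le_of_linearEquiv_of_comm hcomm e.symm).antisymm (le_of_linearEquiv_of_comm hcomm e)

/-- A simple submodule of a semisimple module which is the sum of simple submodules `S i` is
isomorphic to one of them. -/
theorem Submodule.exists_linearEquiv_of_iSup_eq_top [IsSemisimpleModule R M] {ι : Type*}
    (S : ι → Submodule R M) [∀ i, IsSimpleModule R (S i)] (hS : ⨆ i, S i = ⊤)
    (T : Submodule R M) [IsSimpleModule R T] : ∃ i, Nonempty (S i ≃ₗ[R] T) := by
  obtain ⟨T', hT'⟩ := ComplementedLattice.exists_isCompl T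
  let q := T.projectionOnto T' hT'
  by_contra! h
  -- By Schur's lemma the projection to `T` is zero or an isomorphism on each `S i`; it cannot
  -- vanish on all of them.
  have h0 : ∀ i, S i ≤ LinearMap.ker q := fun i x hx => by
    rcases (q ∘ₗ (S i).subtype).bijective_or_eq_zero with hb | h0
    · exact ((h i).false (LinearEquiv.ofBijective _ hb)).elim
    · exact LinearMap.congr_fun h0 ⟨x, hx⟩
  have h1 : LinearMap.ker q = ⊤ := top_le_iff.1 (hS ▸ iSup_le h0)
  have := IsSimpleModule.nontrivial R T
  obtain ⟨x, hx⟩ := exists_ne (0 : T)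
  refine hx ?_
  rw [← T.projectionOnto_apply_left hT' x]
  exact LinearMap.mem_ker.1 (h1 ▸ Submodule.mem_top)

variable (R M) in
theorem IsSemisimpleModule.exists_fin_iSupIndep [IsSemisimpleModule R M] [IsNoetherian R M] :
    ∃ (n : ℕ) (V : Fin n → Submodule R M), Function.Injective V ∧ iSupIndep V ∧ ⨆ j, V j = ⊤ ∧
      ∀ j, IsSimpleModule R (V j) := by
  obtain ⟨s, hs, hs', hs''⟩ := IsSemisimpleModule.exists_sSupIndep_sSup_simples_eq_top R M
  have : Finite s := WellFoundedGT.finite_of_sSupIndep hs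
  obtain ⟨n, ⟨f⟩⟩ := Finite.exists_equiv_fin s
  refine ⟨n, fun j => (f.symm j : Submodule R M), Subtype.val_injective.comp f.symm.injective,
    ((sSupIndep_iff s).1 hs).comp f.symm.injective, ?_, fun j => hs'' _ (f.symm j).2⟩
  rw [← hs', sSup_eq_iSup']
  exact f.symm.iSup_comp (g := fun x : s => (x : Submodule R M))

end SemisimpleModules

/-! ### Subrepresentations as submodules over the algebra of operators. -/

namespace Coaction

section OpAlgebra

variable {K A V : Type*} [Field K] [AddCommGroup A] [Module K A] [Coalgebra K A]
  [AddCommGroup V] [Module K V]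

/-- The algebra of operators on `V` generated by the coaction. -/
def opAlgebra (ρ : Coaction K A V) : Subalgebra K (Module.End K V) :=
  Algebra.adjoin K (Set.range (coactOp ρ.map))

variable (ρ : Coaction K A V)

/-- The operator attached to a functional, as an element of the operator algebra. -/
def op (φ : A →ₗ[K] K) : ρ.opAlgebra :=
  ⟨coactOp ρ.map φ, Algebra.subset_adjoin (Set.mem_range_self φ)⟩

/-- A subrepresentation as a module over the operator algebra. -/
def stableSubmodule (U : Submodule K V) (hU : ρ.IsStable U) : Submodule ρ.opAlgebra V where
  __ := U
  smul_mem' := by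
    rintro ⟨r, hr⟩ x hx
    change r x ∈ U
    replace hx : x ∈ U := hx
    induction hr using Algebra.adjoin_induction generalizing x with
    | mem r h => obtain ⟨φ, rfl⟩ := h; exact (ρ.isStable_iff U).1 hU φ x hx
    | algebraMap c => exact U.smul_mem c hx
    | add r s _ _ hr hs => exact U.add_mem (hr hx) (hs hx)
    | mul r s _ _ hr hs => exact hr (hs hx)

theorem isStable_restrictScalars (P : Submodule ρ.opAlgebra V) :
    ρ.IsStable (P.restrictScalars K) :=
  (ρ.isStable_iff _).2 fun φ _ hu => P.smul_mem (ρ.op φ) hu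

theorem map_opAlgebra_smul {V' V'' : Type*} [AddCommGroup V'] [Module ρ.opAlgebra V']
    [AddCommGroup V''] [Module ρ.opAlgebra V''] [Module K V'] [Module K V'']
    [IsScalarTower K ρ.opAlgebra V'] [IsScalarTower K ρ.opAlgebra V'']
    (e : V' →ₗ[K] V'') (he : ∀ φ v, e (ρ.op φ • v) = ρ.op φ • e v) (r : ρ.opAlgebra) (v : V') :
    e (r • v) = r • e v := by
  obtain ⟨r, hr⟩ := r
  induction hr using Algebra.adjoin_induction generalizing v with
  | mem r h => obtain ⟨φ, rfl⟩ := h; exact he φ v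
  | algebraMap c =>
    have h1 : ∀ x : V', (algebraMap K ρ.opAlgebra c) • x = c • x := fun x => algebraMap_smul _ _ _
    have h2 : ∀ x : V'', (algebraMap K ρ.opAlgebra c) • x = c • x := fun x => algebraMap_smul _ _ _
    exact (congrArg e (h1 v)).trans ((map_smul e c v).trans (h2 _).symm)
  | add r s h h' hr hs =>
    have h1 : (⟨r + s, add_mem h h'⟩ : ρ.opAlgebra) = ⟨r, h⟩ + ⟨s, h'⟩ := rfl
    rw [h1, add_smul, add_smul, map_add, hr, hs]
  | mul r s h h' hr hs =>
    have h1 : (⟨r * s, mul_mem h h'⟩ : ρ.opAlgebra) = ⟨r, h⟩ * ⟨s, h'⟩ := rfl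
    rw [h1, mul_smul, mul_smul, hr, hs]

theorem iso_restrict_iff {U U' : Submodule K V} (hU : ρ.IsStable U) (hU' : ρ.IsStable U') :
    Iso (ρ.restrict U hU) (ρ.restrict U' hU') ↔
      Nonempty (ρ.stableSubmodule U hU ≃ₗ[ρ.opAlgebra] ρ.stableSubmodule U' hU') := by
  rw [iso_iff]
  constructor
  · rintro ⟨e, he⟩
    refine ⟨{ e with map_smul' := fun r v => ?_ }⟩
    refine ρ.map_opAlgebra_smul (V' := ρ.stableSubmodule U hU)
      (V'' := ρ.stableSubmodule U' hU') e.toLinearMap (fun φ v => ?_) r v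
    have h1 := congrArg Subtype.val (he φ v)
    rw [coe_coactOp_restrict] at h1
    refine Subtype.ext (Eq.trans ?_ h1)
    refine congrArg (fun x => (e x : V)) (Subtype.ext ?_)
    exact (ρ.coe_coactOp_restrict U hU φ v).symm
  · rintro ⟨e⟩
    refine ⟨{ e with map_smul' := fun c v => (e.restrictScalars K).map_smul c v }, fun φ v => ?_⟩
    have h1 := congrArg Subtype.val (e.map_smul (ρ.op φ) v)
    refine Subtype.ext ?_
    rw [coe_coactOp_restrict]
    refine Eq.trans ?_ h1
    refine congrArg (fun x => (e x : V)) (Subtype.ext ?_)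
    exact ρ.coe_coactOp_restrict U hU φ v

theorem isIrreducible_restrict_iff (U : Submodule K V) (hU : ρ.IsStable U) :
    (ρ.restrict U hU).IsIrreducible ↔
      U ≠ ⊥ ∧ ∀ U' ≤ U, ρ.IsStable U' → U' = ⊥ ∨ U' = U := by
  refine and_congr (Submodule.nontrivial_iff_ne_bot) ⟨fun h U' hle hU' => ?_, fun h X hX => ?_⟩
  · have h1 : Submodule.map U.subtype (U'.comap U.subtype) = U' := by
      rw [Submodule.map_comap_subtype, inf_eq_right.2 hle]
    rcases h (U'.comap U.subtype) ((isStable_iff _ _).2 fun φ u hu => by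
      rw [Submodule.mem_comap, Submodule.subtype_apply, coe_coactOp_restrict]
      exact (ρ.isStable_iff U').1 hU' φ u hu) with h0 | h0
    · left; rw [← h1, h0, Submodule.map_bot]
    · right; rw [← h1, h0, Submodule.map_subtype_top]
  · rcases h (X.map U.subtype) (Submodule.map_subtype_le U X) ((ρ.isStable_iff _).2 fun φ u hu => by
      obtain ⟨x, hx, rfl⟩ := hu
      exact ⟨_, (isStable_iff _ _).1 hX φ x hx, ρ.coe_coactOp_restrict U hU φ x⟩) with h0 | h0
    · left
      refine Submodule.map_injective_of_injective U.injective_subtype ?_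
      rw [h0, Submodule.map_bot]
    · right
      refine Submodule.map_injective_of_injective U.injective_subtype ?_
      rw [h0, Submodule.map_subtype_top]

theorem isSimpleModule_stableSubmodule_iff (U : Submodule K V) (hU : ρ.IsStable U) :
    IsSimpleModule ρ.opAlgebra (ρ.stableSubmodule U hU) ↔ (ρ.restrict U hU).IsIrreducible := by
  have key : ∀ P Q : Submodule ρ.opAlgebra V,
      P.restrictScalars K = Q.restrictScalars K ↔ P = Q :=
    fun P Q => Submodule.restrictScalars_inj ..
  rw [isSimpleModule_iff_isAtom, isIrreducible_restrict_iff]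
  refine and_congr (not_congr (key (ρ.stableSubmodule U hU) ⊥).symm) ⟨fun h U' hle hU' => ?_,
    fun h P hP => ?_⟩
  · rcases eq_or_ne U' U with h1 | h1
    · exact Or.inr h1
    · left
      have h2 : ρ.stableSubmodule U' hU' < ρ.stableSubmodule U hU :=
        lt_of_le_of_ne (fun x hx => hle hx) fun h3 => h1 ((key _ _).2 h3)
      exact (key _ _).2 (h _ h2)
  · rcases h (P.restrictScalars K) (fun x hx => hP.le hx)
      (ρ.isStable_restrictScalars P) with h1 | h1
    · exact (key _ _).1 h1
    · exact absurd ((key P (ρ.stableSubmodule U hU)).1 h1) hP.ne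

theorem iSup_stableSubmodule_eq_top {ι : Type*} (C : ι → Submodule K V)
    (hC : ∀ i, ρ.IsStable (C i)) (htop : ⨆ i, C i = ⊤) :
    ⨆ i, ρ.stableSubmodule (C i) (hC i) = ⊤ := by
  have h2 : ⨆ i, C i ≤ (⨆ i, ρ.stableSubmodule (C i) (hC i)).restrictScalars K :=
    iSup_le fun i v hv => Submodule.mem_iSup_of_mem
      (p := fun i => ρ.stableSubmodule (C i) (hC i)) i hv
  exact (Submodule.eq_top_iff').2 fun v => h2 (htop ▸ Submodule.mem_top)

/-- Suppose that the images of every nonzero subrepresentation under a family of operations that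
preserve irreducible subrepresentations span `V`. Then `V` has an irreducible subrepresentation and
is semisimple. -/
theorem exists_isIrreducible_and_isSemisimpleModule [FiniteDimensional K V] [Nontrivial V]
    {ι : Type*} (C : ι → Submodule K V → Submodule K V)
    (hC : ∀ i U, ρ.IsStable U → ρ.IsStable (C i U))
    (hirr : ∀ i U (hU : ρ.IsStable U), (ρ.restrict U hU).IsIrreducible →
      (ρ.restrict (C i U) (hC i U hU)).IsIrreducible)
    (htop : ∀ U, ρ.IsStable U → U ≠ ⊥ → ⨆ i, C i U = ⊤) :
    (∃ U, ∃ hU : ρ.IsStable U, (ρ.restrict U hU).IsIrreducible) ∧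
      IsSemisimpleModule ρ.opAlgebra V := by
  have : IsArtinian ρ.opAlgebra V := isArtinian_of_tower K inferInstance
  -- A minimal nonzero submodule is irreducible, and its images under `C` are simple and span `V`.
  obtain ⟨S, hS⟩ := IsAtomic.exists_atom (Submodule ρ.opAlgebra V)
  have hSi : (ρ.restrict (S.restrictScalars K) (ρ.isStable_restrictScalars S)).IsIrreducible :=
    (ρ.isSimpleModule_stableSubmodule_iff _ _).1 (isSimpleModule_iff_isAtom.2 hS)
  refine ⟨⟨_, _, hSi⟩, .of_sSup_simples_eq_top (top_le_iff.1 ?_)⟩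
  rw [← ρ.iSup_stableSubmodule_eq_top _ (fun i => hC i _ (ρ.isStable_restrictScalars S))
    (htop _ (ρ.isStable_restrictScalars S) ((ρ.isIrreducible_restrict_iff _ _).1 hSi).1)]
  exact iSup_le fun i => le_sSup ((ρ.isSimpleModule_stableSubmodule_iff _ _).2 (hirr i _ _ hSi))

section Comm

variable (hcomm : ∀ t t' : V →ₗ[K] V, (∀ φ v, t (coactOp ρ.map φ v) = coactOp ρ.map φ (t v)) →
  (∀ φ v, t' (coactOp ρ.map φ v) = coactOp ρ.map φ (t' v)) → t ∘ₗ t' = t' ∘ₗ t)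
  (hss : IsSemisimpleModule ρ.opAlgebra V)

include hcomm hss

/-- If `V` is semisimple and its endomorphisms commute, then isomorphic subrepresentations of `V`
are equal. -/
theorem eq_of_iso_of_comm {U U' : Submodule K V} (hU : ρ.IsStable U) (hU' : ρ.IsStable U')
    (h : Iso (ρ.restrict U hU) (ρ.restrict U' hU')) : U = U' := by
  obtain ⟨e⟩ := (ρ.iso_restrict_iff hU hU').1 h
  have h1 := Submodule.eq_of_linearEquiv_of_comm (fun t t' => LinearMap.ext fun v =>
    LinearMap.congr_fun (hcomm (t.restrictScalars K) (t'.restrictScalars K)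
      (fun φ v => t.map_smul (ρ.op φ) v) (fun φ v => t'.map_smul (ρ.op φ) v)) v) e
  exact congrArg (fun P : Submodule ρ.opAlgebra V => P.restrictScalars K) h1

theorem isotypicComponent_restrict_of_comm (U : Submodule K V) (hU : ρ.IsStable U) :
    ρ.isotypicComponent (ρ.restrict U hU) = U := by
  refine le_antisymm (sSup_le ?_) (le_sSup ⟨hU, LinearEquiv.refl K U, by ext; simp⟩)
  rintro U' ⟨hU', h⟩
  exact (ρ.eq_of_iso_of_comm hcomm hss hU' hU h).le

/-- `U` is isomorphic to some `C i` because these span, and isomorphic subrepresentations are equal.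
-/
theorem exists_eq_of_iSup_eq_top {ι : Type*} (C : ι → Submodule K V)
    (hC : ∀ i, ρ.IsStable (C i)) (hirr : ∀ i, (ρ.restrict (C i) (hC i)).IsIrreducible)
    (htop : ⨆ i, C i = ⊤) {U : Submodule K V} (hU : ρ.IsStable U)
    (h : (ρ.restrict U hU).IsIrreducible) : ∃ i, U = C i := by
  have h1 := fun i => (ρ.isSimpleModule_stableSubmodule_iff _ _).2 (hirr i)
  have h2 := (ρ.isSimpleModule_stableSubmodule_iff _ _).2 h
  obtain ⟨i, ⟨e⟩⟩ := Submodule.exists_linearEquiv_of_iSup_eq_top _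
    (ρ.iSup_stableSubmodule_eq_top C hC htop) (ρ.stableSubmodule U hU)
  exact ⟨i, (ρ.eq_of_iso_of_comm hcomm hss _ _ ((ρ.iso_restrict_iff (hC i) hU).2 ⟨e⟩)).symm⟩

theorem exists_decomposition_of_comm [FiniteDimensional K V] :
    ∃ (n : ℕ) (X : Fin n → Submodule K V) (hX : ∀ j, ρ.IsStable (X j)), DirectSum.IsInternal X ∧
      (∀ j, (ρ.restrict (X j) (hX j)).IsIrreducible) ∧
      ∀ j k, j ≠ k → ¬ Iso (ρ.restrict (X j) (hX j)) (ρ.restrict (X k) (hX k)) := by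
  have : IsNoetherian ρ.opAlgebra V := isNoetherian_of_tower K inferInstance
  obtain ⟨n, X, hinj, hind, htop, hXs⟩ :=
    IsSemisimpleModule.exists_fin_iSupIndep ρ.opAlgebra V
  refine ⟨n, fun j => (X j).restrictScalars K, fun j => ρ.isStable_restrictScalars _, ?_,
    fun j => (ρ.isSimpleModule_stableSubmodule_iff _ _).1 (hXs j), fun j k hjk h => hjk ?_⟩
  · exact DirectSum.isInternal_submodule_of_iSupIndep_of_iSup_eq_top (A := X) hind htop
  · exact hinj (Submodule.restrictScalars_injective K _ _
      (ρ.eq_of_iso_of_comm hcomm hss _ _ h))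

end Comm

end OpAlgebra

end Coaction

/-! ### Galois conjugation of subrepresentations. -/

namespace Coaction

section Conjugation

variable {K A L : Type*} [Field K] [CommRing A] [HopfAlgebra K A] [Field L] [Algebra K L]

/-- The functional `γ ∘ φ ∘ γ⁻¹` on `A_L`. -/
def conjFunctional (γ : L ≃ₐ[K] L) (φ : L ⊗[K] A →ₗ[L] L) : L ⊗[K] A →ₗ[L] L where
  toFun x := γ (φ (galMap A γ.symm x))
  map_add' x y := by simp
  map_smul' l x := by simp [LinearMap.map_smulₛₗ]

theorem coactOp_conj {V : Type*} [AddCommGroup V] [Module L V] (γ : L ≃ₐ[K] L)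
    (ρ : Coaction L (L ⊗[K] A) V) (φ : L ⊗[K] A →ₗ[L] L) (v : V) :
    coactOp (conj γ ρ).map φ (toConj γ V v) =
      toConj γ V (coactOp ρ.map (conjFunctional γ φ) v) := by
  rw [coactOp_apply, coactOp_apply]
  change TensorProduct.lid L _ (φ.rTensor _ (conjAux γ A V (ρ.map v))) = _
  generalize ρ.map v = z
  induction z using TensorProduct.induction_on with
  | zero => simp
  | add x y hx hy => simp only [map_add, hx, hy]
  | tmul a v =>
    simp only [conjAux, TensorProduct.map_tmul, LinearMap.rTensor_tmul, TensorProduct.lid_tmul,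
      LinearMap.map_smulₛₗ]
    congr 1
    simp [conjFunctional]

variable {W : Type*} [AddCommGroup W] [Module K W]

/-- The semilinear action twists functionals as the conjugate representation does in `coactOp_conj`;
hence `γ⁻¹(U)`, the `comap`, is isomorphic to `γ_* U`. -/
theorem galTensor_coactOp (ρ : Coaction K A W) (γ : L ≃ₐ[K] L) (φ : L ⊗[K] A →ₗ[L] L)
    (v : L ⊗[K] W) : galTensor W γ (coactOp (ρ.baseChange L).map φ v) =
      coactOp (ρ.baseChange L).map (conjFunctional γ φ) (galTensor W γ v) := by
  rw [coactOp_baseChange, coactOp_baseChange, galTensor_coactOpL]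
  congr 2
  ext a
  simp [conjFunctional, galMap_tmul]

theorem isStable_comap_galTensor (ρ : Coaction K A W) (γ : L ≃ₐ[K] L)
    {U : Submodule L (L ⊗[K] W)} (hU : (ρ.baseChange L).IsStable U) :
    (ρ.baseChange L).IsStable (U.comap (galTensor W γ)) :=
  (isStable_iff _ _).2 fun φ u hu => by
    rw [Submodule.mem_comap, galTensor_coactOp]
    exact (isStable_iff _ _).1 hU _ _ hu

theorem comap_galTensor_comap (γ δ : L ≃ₐ[K] L) (U : Submodule L (L ⊗[K] W)) :
    (U.comap (galTensor W γ)).comap (galTensor W δ) = U.comap (galTensor W (γ * δ)) := by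
  ext v
  simp only [Submodule.mem_comap, galTensor_mul]

theorem comap_galTensor_one (U : Submodule L (L ⊗[K] W)) :
    U.comap (galTensor W (1 : L ≃ₐ[K] L)) = U := by
  ext v
  rw [Submodule.mem_comap, galTensor_one]

theorem isIrreducible_restrict_comap (ρ : Coaction K A W) (γ : L ≃ₐ[K] L)
    {U : Submodule L (L ⊗[K] W)} (hU : (ρ.baseChange L).IsStable U)
    (h : ((ρ.baseChange L).restrict U hU).IsIrreducible) :
    ((ρ.baseChange L).restrict _ (ρ.isStable_comap_galTensor γ hU)).IsIrreducible := by
  rw [isIrreducible_restrict_iff] at h ⊢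
  have hbot : ∀ δ : L ≃ₐ[K] L, (⊥ : Submodule L (L ⊗[K] W)).comap (galTensor W δ) = ⊥ := by
    intro δ
    refine (Submodule.eq_bot_iff _).2 fun v hv => ?_
    rw [Submodule.mem_comap, Submodule.mem_bot] at hv
    rw [← galTensor_one v, ← inv_mul_cancel δ, galTensor_mul, hv, map_zero]
  have hcancel : ∀ U' : Submodule L (L ⊗[K] W),
      (U'.comap (galTensor W γ⁻¹)).comap (galTensor W γ) = U' := fun U' => by
    rw [comap_galTensor_comap, inv_mul_cancel, comap_galTensor_one]
  have hcancel' : ∀ U' : Submodule L (L ⊗[K] W),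
      (U'.comap (galTensor W γ)).comap (galTensor W γ⁻¹) = U' := fun U' => by
    rw [comap_galTensor_comap, mul_inv_cancel, comap_galTensor_one]
  refine ⟨fun h0 => h.1 ?_, fun U' hle hU' => ?_⟩
  · rw [← hcancel' U, h0, hbot]
  · rcases h.2 (U'.comap (galTensor W γ⁻¹)) (by
      rw [← hcancel' U]; exact Submodule.comap_mono hle)
      (ρ.isStable_comap_galTensor γ⁻¹ hU') with h0 | h0
    · left; rw [← hcancel U', h0, hbot]
    · right; rw [← hcancel U', h0]

theorem iso_conj_of_eq_comap (ρ : Coaction K A W) (γ : L ≃ₐ[K] L)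
    {U U' : Submodule L (L ⊗[K] W)} (hU : (ρ.baseChange L).IsStable U)
    (hU' : (ρ.baseChange L).IsStable U') (h : U' = U.comap (galTensor W γ)) :
    Iso ((ρ.baseChange L).restrict U' hU') (conj γ ((ρ.baseChange L).restrict U hU)) := by
  subst h
  rw [iso_iff]
  let f : U.comap (galTensor W γ) →ₗ[L] Conj γ U :=
    { toFun := fun v => toConj γ U ⟨galTensor W γ v, v.2⟩
      map_add' := fun v w => by
        rw [← map_add]
        exact congrArg (toConj γ U) (Subtype.ext (map_add (galTensor W γ) v.1 w.1))
      map_smul' := fun l v =>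
        congrArg (toConj γ U) (Subtype.ext ((galTensor W γ).map_smulₛₗ l v.1)) }
  have hf : Function.Bijective f := by
    constructor
    · intro v w hvw
      have h1 : galTensor W γ v = galTensor W γ w := congrArg Subtype.val (α := U) hvw
      refine Subtype.ext ?_
      rw [← galTensor_one v.1, ← inv_mul_cancel γ, galTensor_mul, h1, ← galTensor_mul,
        inv_mul_cancel, galTensor_one]
    · intro u
      have hu : galTensor W γ (galTensor W γ⁻¹ (ofConj γ U u : U)) = (ofConj γ U u : U) := by
        rw [← galTensor_mul, mul_inv_cancel, galTensor_one]
      refine ⟨⟨galTensor W γ⁻¹ (ofConj γ U u : U), ?_⟩, ?_⟩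
      · rw [Submodule.mem_comap, hu]; exact Subtype.coe_prop _
      · exact congrArg (toConj γ U) (Subtype.ext hu)
  refine ⟨LinearEquiv.ofBijective f hf, fun φ v => ?_⟩
  rw [LinearEquiv.ofBijective_apply, LinearEquiv.ofBijective_apply]
  refine Eq.trans ?_ (coactOp_conj γ _ φ (⟨galTensor W γ v, v.2⟩ : U)).symm
  refine congrArg (toConj γ U) (Subtype.ext ?_)
  change galTensor W γ (coactOp _ φ v).1 = _
  rw [coe_coactOp_restrict, coe_coactOp_restrict, galTensor_coactOp]

end Conjugation

/-! ### The decomposition of the base extension. -/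

section Decomposition

variable {K A L W : Type*} [Field K] [CommRing A] [HopfAlgebra K A] [Field L] [Algebra K L]
  [AddCommGroup W] [Module K W]

/-- The conjugates of a nonzero subrepresentation span the base extension of an irreducible
representation. -/
theorem iSup_comap_galTensor_eq_top [IsGalois K L] [FiniteDimensional K W] (ρ : Coaction K A W)
    (hρ : ρ.IsIrreducible) {U : Submodule L (L ⊗[K] W)} (hU : (ρ.baseChange L).IsStable U)
    (hU0 : U ≠ ⊥) : ⨆ γ : L ≃ₐ[K] L, U.comap (galTensor W γ) = ⊤ := by
  set N := ⨆ γ : L ≃ₐ[K] L, U.comap (galTensor W γ) with hN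
  have hstable : ∀ ψ, N ≤ N.comap (coactOpL L ρ.map ψ) := fun ψ => iSup_le fun γ v hv =>
    Submodule.mem_iSup_of_mem γ
      ((ρ.isStable_baseChange_iff _).1 (ρ.isStable_comap_galTensor γ hU) ψ v hv)
  have hle : U ≤ N := by
    conv_lhs => rw [← comap_galTensor_one U]
    exact le_iSup (fun γ : L ≃ₐ[K] L => U.comap (galTensor W γ)) 1
  obtain ⟨w, hw, hwN⟩ := exists_one_tmul_mem N (fun h => hU0 (le_bot_iff.1 (h ▸ hle)))
    fun δ v hv => by
      have h1 : N ≤ N.comap (galTensor W δ) := iSup_le fun γ v hv =>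
        Submodule.mem_iSup_of_mem (γ * δ⁻¹) (by
          rw [Submodule.mem_comap, ← galTensor_mul, inv_mul_cancel_right]
          exact hv)
      exact h1 hv
  -- The rational vectors of `N` form a subrepresentation of `W`, nonzero by descent, hence all of
  -- `W`.
  let N₀ : Submodule K W := (N.restrictScalars K).comap (TensorProduct.mk K L W 1)
  have hN₀ : N₀ = ⊤ := (hρ.2 N₀ ((isStable_iff _ _).2 fun φ u hu => by
    have h2 : coactOpL L ρ.map (Algebra.linearMap K L ∘ₗ φ) (1 ⊗ₜ u) ∈ N := hstable _ hu
    rw [coactOpL_linearMap_tmul] at h2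
    exact h2)).resolve_left fun h0 => hw <| by
      have h2 : w ∈ N₀ := hwN
      rwa [h0, Submodule.mem_bot] at h2
  refine (Submodule.eq_top_iff').2 fun v => ?_
  induction v using TensorProduct.induction_on with
  | zero => exact N.zero_mem
  | add x y hx hy => exact N.add_mem hx hy
  | tmul l w =>
    have h2 : w ∈ N₀ := hN₀ ▸ Submodule.mem_top
    have h3 : (1 : L) ⊗ₜ[K] w ∈ N := h2
    have h4 := N.smul_mem l h3
    rwa [TensorProduct.smul_tmul', smul_eq_mul, mul_one] at h4

variable (L) in
/-- If the endomorphisms of the irreducible representation `W` commute, then `L ⊗ W` is the direct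
sum of finitely many pairwise nonisomorphic irreducible representations, conjugate to each other,
and its isotypic components are irreducible. -/
theorem multiplicity_eq_one_and_exists_decomposition [IsGalois K L] [FiniteDimensional K W]
    (ρ : Coaction K A W) (hρ : ρ.IsIrreducible)
    (hD : ∀ d d' : W →ₗ[K] W, (∀ φ w, d (coactOp ρ.map φ w) = coactOp ρ.map φ (d w)) →
      (∀ φ w, d' (coactOp ρ.map φ w) = coactOp ρ.map φ (d' w)) → ∀ w, d (d' w) = d' (d w)) :
    ρ.multiplicity L = 1 ∧
    ∃ (n : ℕ) (V : Fin n → Submodule L (L ⊗[K] W))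
      (hV : ∀ j, (ρ.baseChange L).IsStable (V j)),
      DirectSum.IsInternal V ∧
      (∀ j, ((ρ.baseChange L).restrict (V j) (hV j)).IsIrreducible) ∧
      (∀ j k, j ≠ k → ¬ Coaction.Iso ((ρ.baseChange L).restrict (V j) (hV j))
        ((ρ.baseChange L).restrict (V k) (hV k))) ∧
      (∀ j k, ∃ γ : L ≃ₐ[K] L, Coaction.Iso ((ρ.baseChange L).restrict (V k) (hV k))
        (Coaction.conj γ ((ρ.baseChange L).restrict (V j) (hV j)))) := by
  have := hρ.1
  have : Nontrivial (L ⊗[K] W) :=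
    (Module.FaithfullyFlat.tensorProduct_mk_injective (A := K) (B := L) W).nontrivial
  have hcomm : ∀ t t' : L ⊗[K] W →ₗ[L] L ⊗[K] W,
      (∀ φ v, t (coactOp (ρ.baseChange L).map φ v) = coactOp (ρ.baseChange L).map φ (t v)) →
      (∀ φ v, t' (coactOp (ρ.baseChange L).map φ v) = coactOp (ρ.baseChange L).map φ (t' v)) →
      t ∘ₗ t' = t' ∘ₗ t := fun t t' ht ht' =>
    baseChange_endomorphisms_comm ρ.map hD t t'
      ((ρ.forall_coactOp_baseChange (P := fun T => ∀ v, t (T v) = T (t v))).1 ht)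
      ((ρ.forall_coactOp_baseChange (P := fun T => ∀ v, t' (T v) = T (t' v))).1 ht')
  have hirr := fun γ U hU hU' => ρ.isIrreducible_restrict_comap (L := L) γ (U := U) hU hU'
  have htop := fun U hU hU0 => ρ.iSup_comap_galTensor_eq_top (L := L) hρ (U := U) hU hU0
  obtain ⟨⟨S, hS, hSi⟩, hss⟩ := (ρ.baseChange L).exists_isIrreducible_and_isSemisimpleModule
    (fun γ : L ≃ₐ[K] L => Submodule.comap (galTensor W γ))
    (fun γ U hU => ρ.isStable_comap_galTensor γ hU) hirr htop
  have hcomp := fun U hU => (ρ.baseChange L).isotypicComponent_restrict_of_comm hcomm hss U hU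
  have hiso : ∀ (U : Submodule L (L ⊗[K] W)) (hU : (ρ.baseChange L).IsStable U),
      Iso ((ρ.baseChange L).restrict U hU) ((ρ.baseChange L).restrict U hU) :=
    fun U hU => ⟨LinearEquiv.refl L U, by ext; simp⟩
  refine ⟨?_, ?_⟩
  · have h1 : ρ.IsMultiplicity L 1 := fun U hU _ => ⟨fun _ => U, fun _ => ⟨hU, hiso U hU⟩,
      iSupIndep_subsingleton _, by rw [iSup_const]; exact (hcomp U hU).symm⟩
    -- Multiplicity 0 would hold vacuously without irreducible subrepresentations; the component of
    -- `S` is `S ≠ 0`, not an empty sum.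
    have h0 : ¬ ρ.IsMultiplicity L 0 := fun h => by
      obtain ⟨X, -, -, h2⟩ := h S hS hSi
      rw [iSup_of_empty] at h2
      exact ((isIrreducible_restrict_iff _ _ _).1 hSi).1 ((hcomp _ _).symm.trans h2.symm)
    have hmem : sInf {m | ρ.IsMultiplicity L m} ∈ {m | ρ.IsMultiplicity L m} :=
      Nat.sInf_mem ⟨1, h1⟩
    have hle : sInf {m | ρ.IsMultiplicity L m} ≤ 1 := Nat.sInf_le h1
    change sInf {m | ρ.IsMultiplicity L m} = 1
    rcases Nat.le_one_iff_eq_zero_or_eq_one.1 hle with h2 | h2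
    · rw [h2] at hmem; exact absurd hmem h0
    · exact h2
  · obtain ⟨n, V, hV, hint, hVi, hne⟩ :=
      (ρ.baseChange L).exists_decomposition_of_comm hcomm hss
    refine ⟨n, V, hV, hint, hVi, hne, fun j k => ?_⟩
    -- The conjugates of `V j` are irreducible and span, so `V k` equals one of them.
    obtain ⟨γ, h⟩ := (ρ.baseChange L).exists_eq_of_iSup_eq_top hcomm hss
      (fun γ : L ≃ₐ[K] L => (V j).comap (galTensor W γ))
      (fun γ => ρ.isStable_comap_galTensor γ (hV j)) (fun γ => hirr γ _ (hV j) (hVi j))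
      (htop _ (hV j) ((isIrreducible_restrict_iff _ _ _).1 (hVi j)).1) (hV k) (hVi k)
    exact ⟨γ, ρ.iso_conj_of_eq_comap γ (hV j) (hV k) h⟩

end Decomposition

end Coaction

end

theorem mainTheorem5 {K : Type*} [Field K] [CharZero K]
    -- `G = Spec A`, a finite group scheme over `K`, with a closed immersion `G → SL(2, K)`
    -- that is a homomorphism of group schemes
    {A : Type*} [CommRing A] [HopfAlgebra K A] [Module.Finite K A]
    (i : SL2Ring K →ₐc[K] A) (hi : Function.Surjective i)
    (L : Type*) [Field L] [Algebra K L] [IsGalois K L]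
    {W : Type*} [AddCommGroup W] [Module K W]
    (ρ : Coaction K A W) (hρ : ρ.IsIrreducible) :
    ρ.multiplicity L = 1 ∧
    ∃ (n : ℕ) (V : Fin n → Submodule L (L ⊗[K] W))
      (hV : ∀ j, (ρ.baseChange L).IsStable (V j)),
      DirectSum.IsInternal V ∧
      (∀ j, ((ρ.baseChange L).restrict (V j) (hV j)).IsIrreducible) ∧
      (∀ j k, j ≠ k → ¬ Coaction.Iso ((ρ.baseChange L).restrict (V j) (hV j))
        ((ρ.baseChange L).restrict (V k) (hV k))) ∧
      (∀ j k, ∃ γ : L ≃ₐ[K] L, Coaction.Iso ((ρ.baseChange L).restrict (V k) (hV k))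
        (Coaction.conj γ ((ρ.baseChange L).restrict (V j) (hV j)))) := by
  have := ρ.finiteDimensional_of_isIrreducible hρ
  exact ρ.multiplicity_eq_one_and_exists_decomposition L hρ
    fun d d' hd hd' w => Coaction.endomorphisms_comm K ρ hρ i hi d d' hd hd' w
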